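/- Let $0\le N\le n$ be integers, let $H\in\mathbb R^{n\times n}$ be symmetric, and let $\eta,\lambda,r>0$. Put $$\mathcal C=\{P\in\mathbb R^{n\times n}: P=P^{\mathrm T},\ \operatorname{tr}P=N,\ 0\preceq P\preceq I\},\qquad \|P\|_1=\sum_{i,j}|P_{ij}|,$$ $$\operatorname{Shrink}(x,t)=\operatorname{sign}(x)\max\{|x|-t,0\}\ \text{ (applied entrywise to matrices)}.$$ For a real function $f$ and a symmetric matrix $A=V\operatorname{diag}(a_1,\dots,a_n)V^{\mathrm T}$ with $V$ orthogonal, let $f(A)=V\operatorname{diag}(f(a_1),\dots,f(a_n))V^{\mathrm T}$, and let $\operatorname{clip}(x)=\min\{\max\{x,0\},1\}$. Let $Q^0,R^0,B^0,D^0\in\mathbb R^{n\times n}$ be arbitrary symmetric matrices (for instance $Q^0=R^0=P^0\in\mathcal C$ and $B^0=D^0=0$). 1. (Zero temperature.) For $k\ge1$ let $$\Gamma^k=\tfrac{\lambda}{\lambda+r}(Q^{k-1}-B^{k-1})+\tfrac{r}{\lambda+r}(R^{k-1}-D^{k-1})-\tfrac1{\lambda+r}H,\qquad P^k=\Gamma^k-\tfrac{\operatorname{tr}\Gamma^k-N}{n}I,$$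 $$Q^k=\operatorname{Shrink}\bigl(P^k+B^{k-1},\tfrac1{\lambda\eta}\bigr),\qquad R^k=\operatorname{clip}(P^k+D^{k-1}),$$ $$B^k=B^{k-1}+P^k-Q^k,\qquad D^k=D^{k-1}+P^k-R^k .$$ Then there is a minimizer $P^*$ of $\operatorname{tr}(HP)+\frac1\eta\|P\|_1$ over $P\in\mathcal C$ such that $(P^k,Q^k,R^k)\to(P^*,P^*,P^*)$. 2. (Finite temperature.) Let $\beta>0$ and let $Z^{k,0}$ $(k\ge1)$ be arbitrary symmetric matrices. For $k\ge1$ let $$Z^{k,l}=\bigl[1+\exp(\beta Y^{k,l})\bigr]^{-1},\quad Y^{k,l}=H+\lambda(Z^{k,l-1}-Q^{k-1}+B^{k-1})+r(Z^{k,l-1}-R^{k-1}+D^{k-1})\quad(l\ge1),$$ let $P^k=\lim_{l\to\infty}Z^{k,l}$, put $M^k=P^k+B^{k-1}$, let $Q^k$ have the off-diagonal entries $Q^k_{ij}=\operatorname{Shrink}(M^k_{ij},\frac1{\lambda\eta})$ $(i\ne j)$ and a diagonal that minimizes $$q\mapsto\tfrac1\eta\sum_i|q_i|+\tfrac\lambda2\sum_i(q_i-M^k_{ii})^2\quad\text{over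 } q\in\mathbb R^n,\ \sum_iq_i=N,$$ and let $R^k=\operatorname{clip}(P^k+D^{k-1})$, $B^k=B^{k-1}+P^k-Q^k$, $D^k=D^{k-1}+P^k-R^k$. If $\beta(\lambda+r)<4$, such a sequence exists (in particular all the inner limits exist). Moreover, for every $\beta>0$ and every sequence generated in this way (with all inner limits existing), there is a minimizer $P^*$ of $$\operatorname{tr}(HP)+\tfrac1\beta\operatorname{tr}\{P\ln P+(1-P)\ln(1-P)\}+\tfrac1\eta\|P\|_1\quad\text{over }P\in\mathcal C$$ (with $0\ln0=0$) such that $(P^k,Q^k,R^k)\to(P^*,P^*,P^*)$. -/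

import Mathlib

open Filter Topology

noncomputable section

namespace LDM

/-- The set of admissible density matrices: real symmetric `n × n` matrices with
`tr P = N` and `0 ⪯ P ⪯ I`. -/
def feasible (n N : ℕ) : Set (Matrix (Fin n) (Fin n) ℝ) :=
  {P | P.IsSymm ∧ P.trace = (N : ℝ) ∧ P.PosSemidef ∧ (1 - P).PosSemidef}

/-- The entrywise `ℓ¹` norm of a matrix. -/
def entrywiseL1 {n : ℕ} (P : Matrix (Fin n) (Fin n) ℝ) : ℝ :=
  ∑ i, ∑ j, |P i j|

/-- The Fermi-Dirac entropy density `x ln x + (1 - x) ln (1 - x)`; since `Real.log 0 = 0`,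
the convention `0 ln 0 = 0` holds at the two endpoints of `[0, 1]`. -/
def entropy (x : ℝ) : ℝ := x * Real.log x + (1 - x) * Real.log (1 - x)

/-- Zero temperature energy `tr (H P) + η⁻¹ ‖P‖₁`. -/
def energyZeroTemp {n : ℕ} (H : Matrix (Fin n) (Fin n) ℝ) (η : ℝ)
    (P : Matrix (Fin n) (Fin n) ℝ) : ℝ :=
  (H * P).trace + 1 / η * entrywiseL1 P

/-- Finite temperature energy
`tr (H P) + β⁻¹ tr (P ln P + (1 - P) ln (1 - P)) + η⁻¹ ‖P‖₁`.
The function of the symmetric matrix `P` is taken in the spectral calculus. -/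
def energyFiniteTemp {n : ℕ} (H : Matrix (Fin n) (Fin n) ℝ) (β η : ℝ)
    (P : Matrix (Fin n) (Fin n) ℝ) : ℝ :=
  (H * P).trace + 1 / β * (cfc entropy P).trace + 1 / η * entrywiseL1 P

/-- `P` solves the zero temperature localized density matrix problem. -/
def IsZeroTempMinimizer {n : ℕ} (H : Matrix (Fin n) (Fin n) ℝ) (N : ℕ) (η : ℝ)
    (P : Matrix (Fin n) (Fin n) ℝ) : Prop :=
  P ∈ feasible n N ∧ IsMinOn (energyZeroTemp H η) (feasible n N) P

/-- `P` solves the finite temperature localized density matrix problem. -/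
def IsFiniteTempMinimizer {n : ℕ} (H : Matrix (Fin n) (Fin n) ℝ) (N : ℕ) (β η : ℝ)
    (P : Matrix (Fin n) (Fin n) ℝ) : Prop :=
  P ∈ feasible n N ∧ IsMinOn (energyFiniteTemp H β η) (feasible n N) P

/-- Scalar soft thresholding `sign x * max (|x| - t) 0`. -/
def shrink (x t : ℝ) : ℝ := Real.sign x * max (|x| - t) 0

/-- Eigenvalue clipping `V min{max{Λ, 0}, 1} Vᵀ` of a symmetric matrix `V Λ Vᵀ`. -/
def clipEig {n : ℕ} (A : Matrix (Fin n) (Fin n) ℝ) : Matrix (Fin n) (Fin n) ℝ :=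
  cfc (fun x : ℝ => min (max x 0) 1) A

/-- The Fermi-Dirac matrix function `[1 + exp (β Y)]⁻¹` of a symmetric matrix `Y`. -/
def fermiDirac {n : ℕ} (β : ℝ) (Y : Matrix (Fin n) (Fin n) ℝ) : Matrix (Fin n) (Fin n) ℝ :=
  cfc (fun x : ℝ => 1 / (1 + Real.exp (β * x))) Y

/-- The variables `(P, Q, R, B, D)` carried by the iterations. -/
structure State (n : ℕ) where
  P : Matrix (Fin n) (Fin n) ℝ
  Q : Matrix (Fin n) (Fin n) ℝ
  R : Matrix (Fin n) (Fin n) ℝ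
  B : Matrix (Fin n) (Fin n) ℝ
  D : Matrix (Fin n) (Fin n) ℝ

/-- The variables that the next iteration reads are symmetric matrices
(the `P` component is never read). -/
def State.IsSymm {n : ℕ} (s : State n) : Prop :=
  s.Q.IsSymm ∧ s.R.IsSymm ∧ s.B.IsSymm ∧ s.D.IsSymm

/-! ### Zero temperature iteration -/

/-- `P = Γ - ((tr Γ - N) / n) I`, where
`Γ = λ/(λ+r) (Q - B) + r/(λ+r) (R - D) - 1/(λ+r) H`. -/
def zeroTempP {n : ℕ} (H : Matrix (Fin n) (Fin n) ℝ) (N : ℕ) (lam r : ℝ) (s : State n) :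
    Matrix (Fin n) (Fin n) ℝ :=
  let Γ : Matrix (Fin n) (Fin n) ℝ :=
    (lam / (lam + r)) • (s.Q - s.B) + (r / (lam + r)) • (s.R - s.D) - (1 / (lam + r)) • H
  Γ - ((Γ.trace - (N : ℝ)) / (n : ℝ)) • (1 : Matrix (Fin n) (Fin n) ℝ)

/-- One pass of the zero temperature algorithm. -/
def zeroTempStep {n : ℕ} (H : Matrix (Fin n) (Fin n) ℝ) (N : ℕ) (η lam r : ℝ) (s : State n) :
    State n :=
  let P := zeroTempP H N lam r s
  let Q : Matrix (Fin n) (Fin n) ℝ := (P + s.B).map (fun x => shrink x (1 / (lam * η)))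
  let R := clipEig (P + s.D)
  { P := P, Q := Q, R := R, B := s.B + P - Q, D := s.D + P - R }

/-! ### Finite temperature iteration -/

/-- The inner iteration: `Z⁰ = Z₀` and `Zˡ⁺¹ = [1 + exp (β Yˡ⁺¹)]⁻¹` with
`Yˡ⁺¹ = H + λ (Zˡ - Q + B) + r (Zˡ - R + D)`. -/
def innerIter {n : ℕ} (H : Matrix (Fin n) (Fin n) ℝ) (β lam r : ℝ) (s : State n)
    (Z₀ : Matrix (Fin n) (Fin n) ℝ) : ℕ → Matrix (Fin n) (Fin n) ℝ
  | 0 => Z₀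
  | l + 1 =>
    fermiDirac β (H + lam • (innerIter H β lam r s Z₀ l - s.Q + s.B)
      + r • (innerIter H β lam r s Z₀ l - s.R + s.D))

/-- `q` is the minimizer of `η⁻¹ ‖q‖₁ + (λ/2) ‖q - m‖²` over vectors with `1ᵀ q = N`. -/
def IsDiagUpdate {n : ℕ} (N : ℕ) (η lam : ℝ) (m q : Fin n → ℝ) : Prop :=
  q ∈ {v : Fin n → ℝ | ∑ i, v i = (N : ℝ)} ∧
    IsMinOn (fun v : Fin n → ℝ => 1 / η * ∑ i, |v i| + lam / 2 * ∑ i, (v i - m i) ^ 2)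
      {v : Fin n → ℝ | ∑ i, v i = (N : ℝ)} q

/-- One pass `s ↦ s'` of the finite temperature algorithm, with inner starting point `Z₀`
and the inner loop run to convergence. -/
structure IsFiniteTempStep {n : ℕ} (H : Matrix (Fin n) (Fin n) ℝ) (N : ℕ) (β η lam r : ℝ)
    (Z₀ : Matrix (Fin n) (Fin n) ℝ) (s s' : State n) : Prop where
  P_eq : Tendsto (innerIter H β lam r s Z₀) atTop (𝓝 s'.P)
  Q_offDiag : ∀ i j, i ≠ j → s'.Q i j = shrink ((s'.P + s.B) i j) (lam * η)⁻¹
  Q_diag : IsDiagUpdate N η lam (s'.P + s.B).diag s'.Q.diag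
  R_eq : s'.R = clipEig (s'.P + s.D)
  B_eq : s'.B = s.B + s'.P - s'.Q
  D_eq : s'.D = s.D + s'.P - s'.R

/-- The sequence `s` is generated by the finite temperature algorithm, the inner loop of the
`(k+1)`-st pass being started at `Z₀ k`. -/
def IsFiniteTempRun {n : ℕ} (H : Matrix (Fin n) (Fin n) ℝ) (N : ℕ) (β η lam r : ℝ)
    (Z₀ : ℕ → Matrix (Fin n) (Fin n) ℝ) (s : ℕ → State n) : Prop :=
  ∀ k, IsFiniteTempStep H N β η lam r (Z₀ k) (s k) (s (k + 1))

/-- The triples `(Pᵏ, Qᵏ, Rᵏ)` converge to `(P, P, P)`. -/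
def ConvergesTo {n : ℕ} (s : ℕ → State n) (P : Matrix (Fin n) (Fin n) ℝ) : Prop :=
  Tendsto (fun k => ((s k).P, (s k).Q, (s k).R)) atTop (𝓝 (P, P, P))

end LDM

end

/-!
With `P` on one side and the pair `(Q, R)` on the other, each pass is one step of the alternating
direction method for `f P + g Q + h R` under the constraint `P = Q`, `P = R`, where `h` is the
indicator of `0 ⪯ X ⪯ I`; equivalently it is one Douglas–Rachford step for `f` on the diagonal and
`g ⊕ h`, in the product space whose two factors are scaled by `√λ` and `√r`. A Douglas–Rachford
operator `T` is firmly nonexpansive, so its orbits converge as soon as it has a fixed point, and a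
fixed point is a minimizer together with multipliers.

Fixed points are obtained without duality: for `s > 0` the equation `T z - z = s z` is solvable, its
solutions stay bounded as `s → 0` under Slater's condition, and any limit point is fixed. Slater's
condition holds at `(N / n) I` when `0 < N < n`. When `N = 0` or `N = n` it may fail and there may
be no multipliers, but then the feasible set is a single point and `P - Q → 0`, `P - R → 0` suffice.

At zero temperature `f` is linear on a trace slice. At finite temperature `f` is the free energy,
whose proximal map solves `p = [1 + exp (β (H + (λ + r) (p - w)))]⁻¹`. In the Frobenius norm the
right-hand side is `β (λ + r) / 4`-Lipschitz and antitone in `p`: averaging it with the identity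
gives a contraction, hence a solution for every `β`, and when `β (λ + r) < 4` it is itself a
contraction, so that the inner loop converges.
-/

namespace LDM

open Matrix
open scoped RealInnerProductSpace

section Nonexpansive

variable {E : Type*} [NormedAddCommGroup E]

/-- Firmly nonexpansive maps: the iteration operators of splitting methods. The definition is the
Hilbert space one, but it makes sense, and gives convergence of orbits, in every normed space. -/
def FirmlyNonexpansive (T : E → E) : Prop :=
  ∀ x y, ‖T x - T y‖ ^ 2 + ‖(T x - x) - (T y - y)‖ ^ 2 ≤ ‖x - y‖ ^ 2

theorem FirmlyNonexpansive.lipschitzWith {T : E → E} (hT : FirmlyNonexpansive T) :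
    LipschitzWith 1 T :=
  LipschitzWith.mk_one fun x y => by
    rw [dist_eq_norm, dist_eq_norm]
    exact le_of_sq_le_sq ((le_add_of_nonneg_right (sq_nonneg _)).trans (hT x y)) (norm_nonneg _)

theorem tendsto_sub_succ_of_antitone {a : ℕ → ℝ} (ha : Antitone a) (h₀ : ∀ k, 0 ≤ a k) :
    Tendsto (fun k => a k - a (k + 1)) atTop (𝓝 0) := by
  have hlim := tendsto_atTop_ciInf ha ⟨0, Set.forall_mem_range.2 h₀⟩
  simpa using hlim.sub (hlim.comp (tendsto_add_atTop_nat 1))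

theorem FirmlyNonexpansive.tendsto_displacement_sub {T : E → E} (hT : FirmlyNonexpansive T)
    (x y : E) :
    Tendsto (fun k => (T^[k + 1] x - T^[k] x) - (T^[k + 1] y - T^[k] y)) atTop (𝓝 0) := by
  have hstep k : ‖(T^[k + 1] x - T^[k] x) - (T^[k + 1] y - T^[k] y)‖ ^ 2
      ≤ ‖T^[k] x - T^[k] y‖ ^ 2 - ‖T^[k + 1] x - T^[k + 1] y‖ ^ 2 := by
    simp only [Function.iterate_succ_apply']
    linarith [hT (T^[k] x) (T^[k] y)]
  have hanti : Antitone fun k => ‖T^[k] x - T^[k] y‖ ^ 2 :=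
    antitone_nat_of_succ_le fun k => sub_nonneg.1 ((sq_nonneg _).trans (hstep k))
  have hsq := squeeze_zero (fun k => sq_nonneg _) hstep
    (tendsto_sub_succ_of_antitone hanti fun k => sq_nonneg _)
  rw [tendsto_zero_iff_norm_tendsto_zero]
  simpa only [Real.sqrt_sq (norm_nonneg _), Real.sqrt_zero] using hsq.sqrt

theorem FirmlyNonexpansive.asymptotically_regular {T : E → E} (hT : FirmlyNonexpansive T)
    (happrox : ∀ ε > 0, ∃ y, ‖T y - y‖ < ε) (x : E) :
    Tendsto (fun k => T^[k + 1] x - T^[k] x) atTop (𝓝 0) := by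
  refine NormedAddGroup.tendsto_nhds_zero.2 fun ε hε => ?_
  obtain ⟨y, hy⟩ := happrox (ε / 2) (half_pos hε)
  filter_upwards [NormedAddGroup.tendsto_nhds_zero.1 (hT.tendsto_displacement_sub x y) _
    (half_pos hε)] with k hxy
  have hyk : ‖T^[k + 1] y - T^[k] y‖ ≤ ‖T y - y‖ := by
    simpa [norm_sub_rev, dist_eq_norm] using
      hT.lipschitzWith.dist_iterate_succ_le_geometric y k
  calc ‖T^[k + 1] x - T^[k] x‖
      = ‖((T^[k + 1] x - T^[k] x) - (T^[k + 1] y - T^[k] y)) + (T^[k + 1] y - T^[k] y)‖ := by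
        rw [sub_add_cancel]
    _ ≤ _ := norm_add_le _ _
    _ < ε / 2 + ε / 2 := add_lt_add hxy (hyk.trans_lt hy)
    _ = ε := add_halves ε

theorem FirmlyNonexpansive.exists_tendsto_iterate [ProperSpace E] {T : E → E}
    (hT : FirmlyNonexpansive T) {y : E} (hy : T y = y) (x : E) :
    ∃ z, T z = z ∧ Tendsto (fun k => T^[k] x) atTop (𝓝 z) := by
  have hreg := hT.asymptotically_regular (fun ε hε => ⟨y, by simpa [hy] using hε⟩) x
  have hanti {z : E} (hz : T z = z) : Antitone fun k => dist (T^[k] x) z :=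
    antitone_nat_of_succ_le fun k => by
      have := hT.lipschitzWith.dist_le_mul (T^[k] x) z
      rwa [hz, NNReal.coe_one, one_mul, ← Function.iterate_succ_apply' T] at this
  obtain ⟨z, -, φ, hφ, hz⟩ := (isCompact_closedBall y (dist x y)).tendsto_subseq
    (x := fun k => T^[k] x) fun k => hanti hy k.zero_le
  have hTz : T z = z := by
    have hlim := ((hT.lipschitzWith.continuous.tendsto z).comp hz).sub hz
    have hzero := hreg.comp hφ.tendsto_atTop
    simp only [Function.comp_def, Function.iterate_succ_apply'] at hlim hzero
    exact sub_eq_zero.1 (tendsto_nhds_unique hlim hzero)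
  refine ⟨z, hTz, tendsto_iff_dist_tendsto_zero.2 ?_⟩
  have hlim := tendsto_atTop_ciInf (hanti hTz) ⟨0, Set.forall_mem_range.2 fun _ => dist_nonneg⟩
  rwa [tendsto_nhds_unique (hlim.comp hφ.tendsto_atTop) (tendsto_iff_dist_tendsto_zero.1 hz)]
    at hlim

variable [NormedSpace ℝ E] {T : E → E}

theorem exists_sub_self_eq_smul [CompleteSpace E] (hT : LipschitzWith 1 T) {s : ℝ} (hs : 0 < s) :
    ∃ z, T z - z = s • z := by
  have hs1 : (0 : ℝ) < 1 + s := by positivity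
  have hcontr : ContractingWith (1 + s)⁻¹.toNNReal fun z => (1 + s)⁻¹ • T z := by
    refine ⟨by simpa [Real.toNNReal_lt_one] using inv_lt_one_of_one_lt₀ (by linarith),
      LipschitzWith.of_dist_le' fun x y => ?_⟩
    rw [dist_smul₀, Real.norm_of_nonneg (by positivity)]
    gcongr
    simpa using hT.dist_le_mul x y
  obtain ⟨z, hz⟩ : ∃ z, (1 + s)⁻¹ • T z = z := ⟨_, hcontr.fixedPoint_isFixedPt⟩
  refine ⟨z, ?_⟩
  rw [inv_smul_eq_iff₀ hs1.ne'] at hz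
  rw [hz]
  module

theorem exists_norm_sub_self_lt [CompleteSpace E] (hT : LipschitzWith 1 T) {A : ℝ}
    (hA : ∀ s ∈ Set.Ioc (0 : ℝ) 1, ∀ z, T z - z = s • z → s * ‖z‖ ^ 2 ≤ A) {ε : ℝ} (hε : 0 < ε) :
    ∃ z, ‖T z - z‖ < ε := by
  obtain ⟨s, ⟨hs₀, hs₁⟩, hsA⟩ : ∃ s ∈ Set.Ioc (0 : ℝ) 1, s * A < ε ^ 2 := by
    have hlim : Tendsto (fun s : ℝ => s * A) (𝓝[>] 0) (𝓝 0) :=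
      tendsto_nhdsWithin_of_tendsto_nhds (by simpa using (continuous_mul_const A).tendsto 0)
    exact (Filter.Eventually.and (Ioc_mem_nhdsGT one_pos)
      (hlim.eventually_lt_const (pow_pos hε 2))).exists
  obtain ⟨z, hz⟩ := exists_sub_self_eq_smul hT hs₀
  refine ⟨z, lt_of_pow_lt_pow_left₀ 2 hε.le ?_⟩
  calc ‖T z - z‖ ^ 2 = s * (s * ‖z‖ ^ 2) := by
        rw [hz, norm_smul, Real.norm_of_nonneg hs₀.le]; ring
    _ ≤ s * A := by gcongr; exact hA s ⟨hs₀, hs₁⟩ z hz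
    _ < ε ^ 2 := hsA

theorem exists_fixedPoint_of_norm_le [ProperSpace E] (hT : LipschitzWith 1 T) {K : ℝ}
    (hK : ∀ᶠ s : ℝ in 𝓝[>] 0, ∀ z, T z - z = s • z → ‖z‖ ≤ K) : ∃ z, T z = z := by
  obtain ⟨s, hs⟩ := exists_seq_tendsto (𝓝[>] (0 : ℝ))
  have hev : ∀ᶠ j in atTop, ∃ z, T z - z = s j • z ∧ ‖z‖ ≤ K := by
    filter_upwards [hs.eventually hK, hs.eventually self_mem_nhdsWithin] with j hj hj₀
    obtain ⟨z, hz⟩ := exists_sub_self_eq_smul hT hj₀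
    exact ⟨z, hz, hj z hz⟩
  obtain ⟨m, hm⟩ := eventually_atTop.1 hev
  choose z hz hzK using fun j => hm (j + m) (Nat.le_add_left m j)
  obtain ⟨y, -, φ, hφ, hy⟩ := (isCompact_closedBall (0 : E) K).tendsto_subseq
    (x := z) (fun j => by simpa using hzK j)
  have hs₀ : Tendsto (fun j => s (φ j + m)) atTop (𝓝 0) :=
    (tendsto_nhds_of_tendsto_nhdsWithin hs).comp
      ((tendsto_add_atTop_nat m).comp hφ.tendsto_atTop)
  have hlim := ((hT.continuous.tendsto y).comp hy).sub hy
  have hzero := hs₀.smul hy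
  simp only [Function.comp_def, ← hz, zero_smul] at hlim hzero
  exact ⟨y, sub_eq_zero.1 (tendsto_nhds_unique hlim hzero)⟩

end Nonexpansive

section Proximal

/-- A function `V → (-∞, ∞]`, encoded by its effective domain and by real values, of which only
those on the domain have a meaning. -/
structure ExtFun (V : Type*) where
  dom : Set V
  toFun : V → ℝ

instance {V : Type*} : CoeFun (ExtFun V) fun _ => V → ℝ := ⟨ExtFun.toFun⟩

variable {E : Type*} [NormedAddCommGroup E] [InnerProductSpace ℝ E]

/-- The point `p` is the proximal point of `w` for `f` with weight `c`, that is, the minimizer of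
`f x + c / 2 * ‖x - w‖ ^ 2`. It is encoded by the variational inequality `c • (w - p) ∈ ∂f p`,
which for convex `f` is equivalent. -/
def IsProxAt (f : ExtFun E) (c : ℝ) (w p : E) : Prop :=
  p ∈ f.dom ∧ ∀ x ∈ f.dom, f p + c * ⟪w - p, x - p⟫ ≤ f x

/-- The map `J` sends every point to its proximal point of weight one. -/
def IsProxMap (f : ExtFun E) (J : E → E) : Prop :=
  ∀ w, IsProxAt f 1 w (J w)

variable {f F G : ExtFun E} {c s : ℝ} {v w p q z : E} {J JF JG : E → E}

theorem IsProxAt.norm_sub_sq_le (hc : 0 < c) (hp : IsProxAt f c w p) (hq : IsProxAt f c v q) :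
    ‖p - q‖ ^ 2 ≤ ⟪w - v, p - q⟫ := by
  have hpq := hp.2 q hq.1
  have hqp := hq.2 p hp.1
  refine le_of_mul_le_mul_left ?_ hc
  rw [← real_inner_self_eq_norm_sq]
  simp only [inner_sub_left, inner_sub_right] at hpq hqp ⊢
  linarith

theorem IsProxAt.unique (hc : 0 < c) (hp : IsProxAt f c w p) (hq : IsProxAt f c w q) : p = q := by
  have h := hp.norm_sub_sq_le hc hq
  rw [sub_self, inner_zero_left] at h
  exact sub_eq_zero.1 (norm_eq_zero.1 (pow_eq_zero_iff two_ne_zero |>.1 (h.antisymm (sq_nonneg _))))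

theorem isProxAt_of_isMinOn (hf : ConvexOn ℝ f.dom f) (hp : p ∈ f.dom)
    (hmin : IsMinOn (fun x => f x + c / 2 * ‖x - w‖ ^ 2) f.dom p) : IsProxAt f c w p := by
  refine ⟨hp, fun x hx => ?_⟩
  set a := f x - f p - c * ⟪w - p, x - p⟫ with ha
  have hsegment : ∀ t ∈ Set.Ioc (0 : ℝ) 1, 0 ≤ a + t * (c / 2 * ‖x - p‖ ^ 2) := by
    rintro t ⟨ht_pos, ht_le⟩
    have hmem : (1 - t) • p + t • x ∈ f.dom :=
      hf.1 hp hx (sub_nonneg.2 ht_le) ht_pos.le (sub_add_cancel 1 t)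
    have hle := (isMinOn_iff.1 hmin _ hmem).trans
      (add_le_add_left (hf.2 hp hx (sub_nonneg.2 ht_le) ht_pos.le (sub_add_cancel 1 t)) _)
    have hnorm : ‖(1 - t) • p + t • x - w‖ ^ 2
        = ‖p - w‖ ^ 2 - 2 * t * ⟪w - p, x - p⟫ + t ^ 2 * ‖x - p‖ ^ 2 := by
      have hpoint : (1 - t) • p + t • x - w = t • (x - p) - (w - p) := by module
      rw [hpoint, norm_sub_sq_real, norm_smul, mul_pow, Real.norm_eq_abs, sq_abs,
        real_inner_smul_left, norm_sub_rev w p, real_inner_comm]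
      ring
    rw [hnorm, smul_eq_mul, smul_eq_mul] at hle
    exact nonneg_of_mul_nonneg_right (by rw [ha]; linarith) ht_pos
  have hlim : Tendsto (fun t : ℝ => a + t * (c / 2 * ‖x - p‖ ^ 2)) (𝓝[>] 0) (𝓝 a) := by
    refine tendsto_nhdsWithin_of_tendsto_nhds (Continuous.tendsto' (by fun_prop) _ _ ?_)
    rw [zero_mul, add_zero]
  have ha_nonneg : 0 ≤ a := ge_of_tendsto hlim <| by
    filter_upwards [Ioc_mem_nhdsGT (zero_lt_one' ℝ)] with t ht using hsegment t ht
  rw [ha] at ha_nonneg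
  linarith

theorem IsProxAt.exists_affine_le (hp : IsProxAt f c w p) :
    ∃ C ≥ 0, ∀ x ∈ f.dom, -C - C * ‖x‖ ≤ f x := by
  refine ⟨|f p| + |c| * ‖w - p‖ * (1 + ‖p‖), by positivity, fun x hx => le_trans ?_ (hp.2 x hx)⟩
  have hinner : -(|c| * ‖w - p‖ * (‖x‖ + ‖p‖)) ≤ c * ⟪w - p, x - p⟫ := by
    refine neg_le_of_abs_le ?_
    rw [abs_mul, mul_assoc]
    gcongr
    exact (abs_real_inner_le_norm _ _).trans (by gcongr; exact norm_sub_le x p)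
  have : 0 ≤ (|f p| + |c| * ‖w - p‖ * ‖p‖) * ‖x‖ := by positivity
  have : 0 ≤ |c| * ‖w - p‖ := by positivity
  linarith [neg_abs_le (f p)]

theorem IsProxMap.lipschitzWith (hJ : IsProxMap f J) : LipschitzWith 1 J :=
  LipschitzWith.mk_one fun x y => by
    rw [dist_eq_norm, dist_eq_norm]
    have h := ((hJ x).norm_sub_sq_le one_pos (hJ y)).trans (real_inner_le_norm _ _)
    by_contra! hlt
    nlinarith [norm_nonneg (x - y), norm_nonneg (J x - J y)]

/-- The Douglas–Rachford operator of two proximal maps. -/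
def drMap (JF JG : E → E) (z : E) : E :=
  z + JF ((2 : ℝ) • JG z - z) - JG z

theorem drMap_sub_self (JF JG : E → E) (z : E) :
    drMap JF JG z - z = JF ((2 : ℝ) • JG z - z) - JG z := by
  simp only [drMap]; abel

theorem firmlyNonexpansive_drMap (hF : IsProxMap F JF) (hG : IsProxMap G JG) :
    FirmlyNonexpansive (drMap JF JG) := by
  intro x y
  have hG' := (hG x).norm_sub_sq_le one_pos (hG y)
  have hF' := (hF ((2 : ℝ) • JG x - x)).norm_sub_sq_le one_pos (hF ((2 : ℝ) • JG y - y))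
  rw [drMap_sub_self, drMap_sub_self]
  simp only [drMap]
  generalize JF ((2 : ℝ) • JG x - x) = qx, JF ((2 : ℝ) • JG y - y) = qy at *
  generalize JG x = px, JG y = py at *
  have hdiff : x + qx - px - (y + qy - py) = (x - y) + ((qx - qy) - (px - py)) := by abel
  have hgap : qx - px - (qy - py) = (qx - qy) - (px - py) := by abel
  have hrefl : (2 : ℝ) • px - x - ((2 : ℝ) • py - y) = (2 : ℝ) • (px - py) - (x - y) := by module
  rw [hrefl] at hF'
  rw [hdiff, hgap]
  generalize x - y = d, qx - qy = q, px - py = p at *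
  simp only [← real_inner_self_eq_norm_sq, inner_sub_left, inner_sub_right, inner_add_left,
    inner_add_right, real_inner_smul_left] at *
  linarith [real_inner_comm p q, real_inner_comm d q, real_inner_comm d p]

theorem energy_add_le_of_drMap_sub_eq_smul (hF : IsProxMap F JF) (hG : IsProxMap G JG)
    (hz : drMap JF JG z - z = s • z) {x y : E} (hx : x ∈ F.dom) (hy : y ∈ G.dom) :
    F (JF ((2 : ℝ) • JG z - z)) + G (JG z) + ⟪z - JG z, y - x⟫ + s * ‖z‖ ^ 2 + s ^ 2 * ‖z‖ ^ 2
      ≤ F x + G y + s * ⟪z, x⟫ := by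
  have hG' := (hG z).2 y hy
  have hF' := (hF ((2 : ℝ) • JG z - z)).2 x hx
  rw [drMap_sub_self] at hz
  rw [sub_eq_iff_eq_add.1 hz] at hF' ⊢
  generalize JG z = p at *
  simp only [← real_inner_self_eq_norm_sq, inner_sub_left, inner_sub_right, inner_add_left,
    inner_add_right, real_inner_smul_left, real_inner_smul_right] at *
  rw [real_inner_comm z p] at *
  linarith

/-- Points of `B` are bounded in terms of their distance to points of `A`. For the domains of two
functions this stands in for coercivity of their sum. -/
def GapBounded (A B : Set E) : Prop :=
  ∃ C ≥ 0, ∀ q ∈ A, ∀ p ∈ B, ‖p‖ ≤ C + C * ‖q - p‖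

/-- The Slater condition for `F + G`: a ball about the origin consists of differences of points of
the two domains, which can be chosen with bounded energy. -/
def SlaterCondition (F G : ExtFun E) : Prop :=
  ∃ ρ > 0, ∃ C, ∀ w, ‖w‖ ≤ ρ → ∃ x ∈ F.dom, x + w ∈ G.dom ∧ ‖x‖ ≤ C ∧ F x + G (x + w) ≤ C

theorem exists_energy_lower_bound (hF : IsProxMap F JF) (hG : IsProxMap G JG)
    (hgap : GapBounded F.dom G.dom) :
    ∃ C, ∀ q ∈ F.dom, ∀ p ∈ G.dom,
      ‖p‖ ≤ C + C * ‖q - p‖ ∧ -C - C * ‖q - p‖ ≤ F q + G p := by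
  obtain ⟨C₀, hC₀, h₀⟩ := hgap
  obtain ⟨C₁, hC₁, h₁⟩ := (hF 0).exists_affine_le
  obtain ⟨C₂, hC₂, h₂⟩ := (hG 0).exists_affine_le
  refine ⟨C₀ + (C₁ + C₂) * (1 + C₀), fun q hq p hp => ?_⟩
  have hpq := h₀ q hq p hp
  have hqp : ‖q‖ ≤ ‖p‖ + ‖q - p‖ := by simpa using norm_add_le p (q - p)
  have hmul : 0 ≤ C₁ * ‖q - p‖ ∧ 0 ≤ (C₁ + C₂) * (1 + C₀) * (1 + ‖q - p‖) := by
    constructor <;> positivity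
  constructor
  · linarith [hmul.2]
  · have hF' : C₁ * ‖q‖ ≤ C₁ * (C₀ + C₀ * ‖q - p‖ + ‖q - p‖) := by gcongr; linarith
    have hG' : C₂ * ‖p‖ ≤ C₂ * (C₀ + C₀ * ‖q - p‖) := by gcongr
    have : 0 ≤ C₂ * ‖q - p‖ := by positivity
    have : 0 ≤ C₀ * ‖q - p‖ := by positivity
    linarith [h₁ q hq, h₂ p hp]

theorem inner_add_sq_norm_le_of_drMap_sub_eq_smul (hF : IsProxMap F JF) (hG : IsProxMap G JG)
    {C : ℝ} (hC : ∀ q ∈ F.dom, ∀ p ∈ G.dom, -C - C * ‖q - p‖ ≤ F q + G p) (hs : 0 ≤ s)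
    (hz : drMap JF JG z - z = s • z) {x y : E} (hx : x ∈ F.dom) (hy : y ∈ G.dom) :
    ⟪z - JG z, y - x⟫ + s * ‖z‖ ^ 2 ≤ F x + G y + C + s * ((‖x‖ + C) * ‖z‖) := by
  have hgap := hC _ (hF ((2 : ℝ) • JG z - z)).1 _ (hG z).1
  rw [← drMap_sub_self, hz, norm_smul, Real.norm_of_nonneg hs] at hgap
  have hinner : s * ⟪z, x⟫ ≤ s * (‖z‖ * ‖x‖) := by gcongr; exact real_inner_le_norm z x
  linarith [energy_add_le_of_drMap_sub_eq_smul hF hG hz hx hy, sq_nonneg (s * ‖z‖)]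

/-- A fixed point need not exist here: the bound on `s * ‖z‖ ^ 2` at the points with
`T z - z = s • z` takes its place. -/
theorem drMap_asymptotically_regular [CompleteSpace E] (hF : IsProxMap F JF) (hG : IsProxMap G JG)
    (hgap : GapBounded F.dom G.dom) {x : E} (hxF : x ∈ F.dom) (hxG : x ∈ G.dom) (z : E) :
    Tendsto (fun k => (drMap JF JG)^[k + 1] z - (drMap JF JG)^[k] z) atTop (𝓝 0) := by
  have hT := firmlyNonexpansive_drMap hF hG
  obtain ⟨C, hC⟩ := exists_energy_lower_bound hF hG hgap
  refine hT.asymptotically_regular (fun ε hε => exists_norm_sub_self_lt hT.lipschitzWith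
    (A := 2 * |F x + G x + C| + (‖x‖ + C) ^ 2) (fun s hs z hz => ?_) hε) z
  have h := inner_add_sq_norm_le_of_drMap_sub_eq_smul hF hG (fun q hq p hp => (hC q hq p hp).2)
    hs.1.le hz hxF hxG
  rw [sub_self, inner_zero_right, zero_add] at h
  have hyoung : 0 ≤ s * (‖z‖ - (‖x‖ + C)) ^ 2 := mul_nonneg hs.1.le (sq_nonneg _)
  have hs₁ : s * (‖x‖ + C) ^ 2 ≤ 1 * (‖x‖ + C) ^ 2 := by gcongr; exact hs.2
  linarith [le_abs_self (F x + G x + C)]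

theorem mul_norm_le_of_inner_le {u : E} {ρ M : ℝ} (hρ : 0 ≤ ρ)
    (h : ∀ w, ‖w‖ ≤ ρ → ⟪u, w⟫ ≤ M) : ρ * ‖u‖ ≤ M := by
  obtain rfl | hu := eq_or_ne u 0
  · simpa using h 0 (by simpa using hρ)
  have hu' := norm_pos_iff.2 hu
  have hball : ‖(ρ / ‖u‖) • u‖ = ρ := by
    rw [norm_smul, Real.norm_of_nonneg (by positivity), div_mul_cancel₀ _ hu'.ne']
  calc ρ * ‖u‖ = ⟪u, (ρ / ‖u‖) • u⟫ := by
        rw [real_inner_smul_right, real_inner_self_eq_norm_sq]; field_simp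
    _ ≤ M := h _ hball.le

theorem exists_norm_sub_prox_le_of_drMap_sub_eq_smul (hF : IsProxMap F JF) (hG : IsProxMap G JG)
    (hgap : GapBounded F.dom G.dom) (hslater : SlaterCondition F G) :
    ∃ K, ∀ s ∈ Set.Ioc (0 : ℝ) 1, ∀ z, drMap JF JG z - z = s • z → ‖z - JG z‖ ≤ K := by
  obtain ⟨C, hC⟩ := exists_energy_lower_bound hF hG hgap
  obtain ⟨ρ, hρ, C', hC'⟩ := hslater
  refine ⟨(C' + C + (C' + C) ^ 2) / ρ, fun s hs z hz => ?_⟩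
  rw [le_div_iff₀' hρ]
  refine mul_norm_le_of_inner_le hρ.le fun w hw => ?_
  obtain ⟨x, hx, hxw, hxC, hE⟩ := hC' w hw
  have h := inner_add_sq_norm_le_of_drMap_sub_eq_smul hF hG (fun q hq p hp => (hC q hq p hp).2)
    hs.1.le hz hx hxw
  rw [add_sub_cancel_left] at h
  have hx' : s * ((‖x‖ + C) * ‖z‖) ≤ s * ((C' + C) * ‖z‖) := by have := hs.1; gcongr
  have hyoung : 0 ≤ s * (2 * ‖z‖ - (C' + C)) ^ 2 := mul_nonneg hs.1.le (sq_nonneg _)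
  have hs₁ : s * (C' + C) ^ 2 ≤ 1 * (C' + C) ^ 2 := by gcongr; exact hs.2
  linarith [sq_nonneg (C' + C)]

theorem exists_drMap_fixedPoint [FiniteDimensional ℝ E] (hF : IsProxMap F JF)
    (hG : IsProxMap G JG) (hgap : GapBounded F.dom G.dom) (hslater : SlaterCondition F G) :
    ∃ z, drMap JF JG z = z := by
  have : ProperSpace E := FiniteDimensional.proper_real E
  obtain ⟨C, hC⟩ := exists_energy_lower_bound hF hG hgap
  obtain ⟨K, hK⟩ := exists_norm_sub_prox_le_of_drMap_sub_eq_smul hF hG hgap hslater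
  refine exists_fixedPoint_of_norm_le (firmlyNonexpansive_drMap hF hG).lipschitzWith
    (K := 2 * (K + C)) ?_
  have hsmall : ∀ᶠ s : ℝ in 𝓝[>] 0, C * s < 1 / 2 :=
    (tendsto_nhdsWithin_of_tendsto_nhds (by simpa using (continuous_const_mul C).tendsto 0)
      ).eventually_lt_const one_half_pos
  filter_upwards [hsmall, Ioc_mem_nhdsGT one_pos] with s hCs hs z hz
  have hp := (hC _ (hF ((2 : ℝ) • JG z - z)).1 _ (hG z).1).1
  rw [← drMap_sub_self, hz, norm_smul, Real.norm_of_nonneg hs.1.le] at hp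
  have hu := hK s hs z hz
  have htri : ‖z‖ ≤ ‖z - JG z‖ + ‖JG z‖ := by simpa using norm_add_le (z - JG z) (JG z)
  have hCz : C * s * ‖z‖ ≤ 1 / 2 * ‖z‖ := by gcongr
  linarith

theorem exists_tendsto_drMap_iterate [FiniteDimensional ℝ E] (hF : IsProxMap F JF)
    (hG : IsProxMap G JG) (hgap : GapBounded F.dom G.dom) (hslater : SlaterCondition F G) (z : E) :
    ∃ x ∈ F.dom ∩ G.dom, IsMinOn (fun y => F y + G y) (F.dom ∩ G.dom) x ∧
      Tendsto (fun k => JG ((drMap JF JG)^[k] z)) atTop (𝓝 x) := by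
  have : ProperSpace E := FiniteDimensional.proper_real E
  obtain ⟨y, hy⟩ := exists_drMap_fixedPoint hF hG hgap hslater
  obtain ⟨w, hw, hlim⟩ := (firmlyNonexpansive_drMap hF hG).exists_tendsto_iterate hy z
  have heq : JF ((2 : ℝ) • JG w - w) = JG w := by
    rw [← sub_eq_zero, ← drMap_sub_self, hw, sub_self]
  refine ⟨JG w, ⟨heq ▸ (hF _).1, (hG w).1⟩, fun x hx => ?_,
    (hG.lipschitzWith.continuous.tendsto w).comp hlim⟩
  have h := energy_add_le_of_drMap_sub_eq_smul (s := 0) hF hG (z := w) (by simp [hw]) hx.1 hx.2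
  simpa [heq] using h

end Proximal

section Consensus

/-- Precomposition of an extended-valued function with a map. -/
def ExtFun.comp {V W : Type*} (f : ExtFun V) (e : W → V) : ExtFun W where
  dom := e ⁻¹' f.dom
  toFun := f ∘ e

/-- The function of pairs which is `f` on the diagonal and `∞` elsewhere. It carries the consensus
constraint that both copies of the variable agree. -/
def ExtFun.diag {V : Type*} (f : ExtFun V) : ExtFun (V × V) where
  dom := {x | x.1 ∈ f.dom ∧ x.2 = x.1}
  toFun x := f x.1

/-- The separable sum `(x, y) ↦ g x + h y`. -/
def ExtFun.prod {V : Type*} (g h : ExtFun V) : ExtFun (V × V) where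
  dom := g.dom ×ˢ h.dom
  toFun x := g x.1 + h x.2

variable {V : Type*} [NormedAddCommGroup V] [InnerProductSpace ℝ V] {f g h : ExtFun V} {lam r : ℝ}

theorem exists_isProxMap (hf : ∀ w, ∃ p, IsProxAt f 1 w p) : ∃ J, IsProxMap f J :=
  Classical.skolem.1 hf

variable [FiniteDimensional ℝ V]

/-- The map `(a, b) ↦ (√lam • a, √r • b)`, under which the weighted norm
`lam * ‖a‖ ^ 2 + r * ‖b‖ ^ 2` becomes the standard one. -/
noncomputable def scaledPair (hlam : 0 < lam) (hr : 0 < r) : (V × V) ≃L[ℝ] WithLp 2 (V × V) :=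
  ((LinearEquiv.prodCongr (.smulOfNeZero ℝ V √lam (Real.sqrt_ne_zero'.2 hlam))
    (.smulOfNeZero ℝ V √r (Real.sqrt_ne_zero'.2 hr))).trans
    (WithLp.linearEquiv 2 ℝ (V × V)).symm).toContinuousLinearEquiv

variable (hlam : 0 < lam) (hr : 0 < r)

theorem inner_scaledPair (x y : V × V) :
    ⟪scaledPair hlam hr x, scaledPair hlam hr y⟫ = lam * ⟪x.1, y.1⟫ + r * ⟪x.2, y.2⟫ := by
  have h (t : ℝ) (ht : 0 < t) (a b : V) : ⟪√t • a, √t • b⟫ = t * ⟪a, b⟫ := by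
    rw [real_inner_smul_left, real_inner_smul_right, ← mul_assoc, Real.mul_self_sqrt ht.le]
  simp [scaledPair, WithLp.prod_inner_apply, h lam hlam, h r hr]

theorem isProxAt_comp_scaledPair_symm {F : ExtFun (V × V)} {w p : V × V} :
    IsProxAt (F.comp (scaledPair hlam hr).symm) 1 (scaledPair hlam hr w) (scaledPair hlam hr p) ↔
      p ∈ F.dom ∧ ∀ x ∈ F.dom,
        F p + (lam * ⟪w.1 - p.1, x.1 - p.1⟫ + r * ⟪w.2 - p.2, x.2 - p.2⟫) ≤ F x := by
  simp only [IsProxAt, ExtFun.comp, Set.mem_preimage, (scaledPair hlam hr).surjective.forall,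
    ContinuousLinearEquiv.symm_apply_apply, Function.comp_apply, ← map_sub, inner_scaledPair,
    Prod.fst_sub, Prod.snd_sub, one_mul]

theorem IsProxAt.diag {a b p : V}
    (hp : IsProxAt f (lam + r) ((lam + r)⁻¹ • (lam • a + r • b)) p) :
    IsProxAt (f.diag.comp (scaledPair hlam hr).symm) 1 (scaledPair hlam hr (a, b))
      (scaledPair hlam hr (p, p)) := by
  refine (isProxAt_comp_scaledPair_symm hlam hr).2 ⟨⟨hp.1, rfl⟩, ?_⟩
  rintro ⟨x, y⟩ ⟨hx, rfl : y = x⟩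
  have hne : lam + r ≠ 0 := by positivity
  have haverage : lam * ⟪a - p, y - p⟫ + r * ⟪b - p, y - p⟫
      = (lam + r) * ⟪(lam + r)⁻¹ • (lam • a + r • b) - p, y - p⟫ := by
    rw [← real_inner_smul_left _ _ (lam + r), smul_sub, smul_inv_smul₀ hne]
    simp only [inner_sub_left, inner_add_left, real_inner_smul_left]
    ring
  exact haverage ▸ hp.2 y hx

theorem IsProxAt.prod {a b p q : V} (hp : IsProxAt g lam a p) (hq : IsProxAt h r b q) :
    IsProxAt ((g.prod h).comp (scaledPair hlam hr).symm) 1 (scaledPair hlam hr (a, b))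
      (scaledPair hlam hr (p, q)) := by
  refine (isProxAt_comp_scaledPair_symm hlam hr).2 ⟨⟨hp.1, hq.1⟩, fun x hx => ?_⟩
  simp only [ExtFun.prod]
  linarith [hp.2 x.1 hx.1, hq.2 x.2 hx.2]

/-- The scaled alternating direction method of multipliers for minimizing `f + g + h`, with the
splitting `P = Q`, `P = R`, penalties `lam` and `r`, and scaled multipliers `B` and `D`. -/
structure IsConsensusADMM (f g h : ExtFun V) (lam r : ℝ) (P Q R B D : ℕ → V) : Prop where
  P_prox : ∀ k, IsProxAt f (lam + r)
    ((lam + r)⁻¹ • (lam • (Q k - B k) + r • (R k - D k))) (P (k + 1))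
  Q_prox : ∀ k, IsProxAt g lam (P (k + 1) + B k) (Q (k + 1))
  R_prox : ∀ k, IsProxAt h r (P (k + 1) + D k) (R (k + 1))
  B_eq : ∀ k, B (k + 1) = B k + P (k + 1) - Q (k + 1)
  D_eq : ∀ k, D (k + 1) = D k + P (k + 1) - R (k + 1)

/-- The proximal points which the alternating direction method needs exist. -/
structure HasProxPoints (f g h : ExtFun V) (lam r : ℝ) : Prop where
  left : ∀ w, ∃ p, IsProxAt f (lam + r) w p
  middle : ∀ w, ∃ p, IsProxAt g lam w p
  right : ∀ w, ∃ p, IsProxAt h r w p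

theorem HasProxPoints.exists_isProxMap_diag (hprox : HasProxPoints f g h lam r) :
    ∃ J, IsProxMap (f.diag.comp (scaledPair hlam hr).symm) J :=
  exists_isProxMap <| (scaledPair hlam hr).surjective.forall.2 fun _ =>
    ⟨_, (hprox.left _).choose_spec.diag hlam hr⟩

theorem HasProxPoints.exists_isProxMap_prod (hprox : HasProxPoints f g h lam r) :
    ∃ J, IsProxMap ((g.prod h).comp (scaledPair hlam hr).symm) J :=
  exists_isProxMap <| (scaledPair hlam hr).surjective.forall.2 fun _ =>
    ⟨_, (hprox.middle _).choose_spec.prod hlam hr (hprox.right _).choose_spec⟩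

variable {P Q R B D : ℕ → V} {JF JG : WithLp 2 (V × V) → WithLp 2 (V × V)}

theorem IsConsensusADMM.proxMap_prod_eq (hadmm : IsConsensusADMM f g h lam r P Q R B D)
    (hG : IsProxMap ((g.prod h).comp (scaledPair hlam hr).symm) JG) (k : ℕ) :
    JG (scaledPair hlam hr (P (k + 1) + B k, P (k + 1) + D k))
      = scaledPair hlam hr (Q (k + 1), R (k + 1)) :=
  (hG _).unique one_pos ((hadmm.Q_prox k).prod hlam hr (hadmm.R_prox k))

theorem IsConsensusADMM.proxMap_diag_eq (hadmm : IsConsensusADMM f g h lam r P Q R B D)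
    (hF : IsProxMap (f.diag.comp (scaledPair hlam hr).symm) JF) (k : ℕ) :
    JF (scaledPair hlam hr (Q k - B k, R k - D k)) = scaledPair hlam hr (P (k + 1), P (k + 1)) :=
  (hF _).unique one_pos ((hadmm.P_prox k).diag hlam hr)

theorem IsConsensusADMM.drMap_sub_self (hadmm : IsConsensusADMM f g h lam r P Q R B D)
    (hF : IsProxMap (f.diag.comp (scaledPair hlam hr).symm) JF)
    (hG : IsProxMap ((g.prod h).comp (scaledPair hlam hr).symm) JG) (k : ℕ) :
    drMap JF JG (scaledPair hlam hr (P (k + 1) + B k, P (k + 1) + D k))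
        - scaledPair hlam hr (P (k + 1) + B k, P (k + 1) + D k)
      = scaledPair hlam hr (P (k + 2) - Q (k + 1), P (k + 2) - R (k + 1)) := by
  have hrefl : (2 : ℝ) • (Q (k + 1), R (k + 1)) - (P (k + 1) + B k, P (k + 1) + D k)
      = (Q (k + 1) - B (k + 1), R (k + 1) - D (k + 1)) := by
    rw [hadmm.B_eq, hadmm.D_eq, Prod.smul_mk, Prod.mk_sub_mk]
    congr 1 <;> module
  rw [LDM.drMap_sub_self, hadmm.proxMap_prod_eq hlam hr hG, ← map_smul, ← map_sub, hrefl,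
    hadmm.proxMap_diag_eq hlam hr hF, ← map_sub, Prod.mk_sub_mk]

theorem IsConsensusADMM.drMap_iterate (hadmm : IsConsensusADMM f g h lam r P Q R B D)
    (hF : IsProxMap (f.diag.comp (scaledPair hlam hr).symm) JF)
    (hG : IsProxMap ((g.prod h).comp (scaledPair hlam hr).symm) JG) (k : ℕ) :
    (drMap JF JG)^[k] (scaledPair hlam hr (P 1 + B 0, P 1 + D 0))
      = scaledPair hlam hr (P (k + 1) + B k, P (k + 1) + D k) := by
  induction k with
  | zero => rfl
  | succ k ih =>
    rw [Function.iterate_succ_apply', ih, ← sub_add_cancel (drMap JF JG _)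
      (scaledPair hlam hr (P (k + 1) + B k, P (k + 1) + D k)),
      hadmm.drMap_sub_self hlam hr hF hG, ← map_add, hadmm.B_eq, hadmm.D_eq, Prod.mk_add_mk]
    congr 2 <;> abel

/-- Slater's condition for `f + g + h`, with the perturbations in the last two summands. -/
def ConsensusSlater (f g h : ExtFun V) : Prop :=
  ∃ ρ > 0, ∃ C, ∀ a b, ‖a‖ ≤ ρ → ‖b‖ ≤ ρ →
    ∃ p ∈ f.dom, p + a ∈ g.dom ∧ p + b ∈ h.dom ∧ ‖p‖ ≤ C ∧ f p + (g (p + a) + h (p + b)) ≤ C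

theorem gapBounded_scaledPair {C : ℝ} (hh : ∀ b ∈ h.dom, ‖b‖ ≤ C) :
    GapBounded (f.diag.comp (scaledPair hlam hr).symm).dom
      ((g.prod h).comp (scaledPair hlam hr).symm).dom := by
  set S := scaledPair (V := V) hlam hr
  set K := ‖(S : V × V →L[ℝ] WithLp 2 (V × V))‖
  set K' := ‖(S.symm : WithLp 2 (V × V) →L[ℝ] V × V)‖
  refine ⟨K * |C| + K * K' + 1, by positivity, S.surjective.forall.2 fun q hq =>
    S.surjective.forall.2 fun p hp => ?_⟩
  obtain ⟨-, hdiag : q.2 = q.1⟩ : q ∈ f.diag.dom := by simpa [ExtFun.comp] using hq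
  obtain ⟨-, hp₂ : p.2 ∈ h.dom⟩ : p ∈ (g.prod h).dom := by simpa [ExtFun.comp] using hp
  have hgap : ‖q - p‖ ≤ K' * ‖S q - S p‖ := by
    simpa [← map_sub] using (S.symm : WithLp 2 (V × V) →L[ℝ] V × V).le_opNorm (S q - S p)
  have hq_norm : ‖q‖ ≤ |C| + ‖q - p‖ := calc
    ‖q‖ = ‖q.2‖ := by rw [Prod.norm_def, hdiag, max_self]
    _ ≤ ‖p.2‖ + ‖q.2 - p.2‖ := norm_le_insert' _ _
    _ ≤ |C| + ‖q - p‖ := add_le_add ((hh _ hp₂).trans (le_abs_self C)) (norm_snd_le (q - p))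
  calc ‖S p‖ ≤ ‖S q‖ + ‖S q - S p‖ := norm_le_insert _ _
    _ ≤ K * (|C| + K' * ‖S q - S p‖) + ‖S q - S p‖ := by
      gcongr
      exact ((S : V × V →L[ℝ] WithLp 2 (V × V)).le_opNorm q).trans <| by
        gcongr
        linarith
    _ ≤ _ := by
      have : 0 ≤ K * |C| * ‖S q - S p‖ := by positivity
      have : 0 ≤ K * K' := by positivity
      linarith

theorem ConsensusSlater.slaterCondition (hslater : ConsensusSlater f g h) :
    SlaterCondition (f.diag.comp (scaledPair hlam hr).symm)
      ((g.prod h).comp (scaledPair hlam hr).symm) := by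
  obtain ⟨ρ, hρ, C, hC⟩ := hslater
  set S := scaledPair (V := V) hlam hr
  set K := ‖(S : V × V →L[ℝ] WithLp 2 (V × V))‖
  set K' := ‖(S.symm : WithLp 2 (V × V) →L[ℝ] V × V)‖
  refine ⟨ρ / (K' + 1), by positivity, max (K * C) C, S.surjective.forall.2 fun w hw => ?_⟩
  have hwρ : ‖w‖ ≤ ρ := calc
    ‖w‖ ≤ K' * ‖S w‖ := by
      simpa using (S.symm : WithLp 2 (V × V) →L[ℝ] V × V).le_opNorm (S w)
    _ ≤ (K' + 1) * (ρ / (K' + 1)) := by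
      gcongr
      exact le_add_of_nonneg_right one_pos.le
    _ = ρ := mul_div_cancel₀ ρ (by positivity)
  obtain ⟨p, hpf, hpg, hph, hpC, henergy⟩ :=
    hC w.1 w.2 ((norm_fst_le w).trans hwρ) ((norm_snd_le w).trans hwρ)
  have hnorm : ‖S (p, p)‖ ≤ K * C := calc
    ‖S (p, p)‖ ≤ K * ‖(p, p)‖ := (S : V × V →L[ℝ] WithLp 2 (V × V)).le_opNorm _
    _ ≤ K * C := by
      gcongr
      simpa using hpC
  refine ⟨S (p, p), ?_, ?_, hnorm.trans (le_max_left _ _), le_trans ?_ (le_max_right _ _)⟩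
  · simpa [ExtFun.comp, ExtFun.diag] using hpf
  · simpa [ExtFun.comp, ExtFun.prod] using ⟨hpg, hph⟩
  · simpa [ExtFun.comp, ExtFun.prod, ExtFun.diag] using henergy

theorem IsConsensusADMM.tendsto_sub_zero (hadmm : IsConsensusADMM f g h lam r P Q R B D)
    (hlam : 0 < lam) (hr : 0 < r) (hprox : HasProxPoints f g h lam r) {C : ℝ}
    (hh : ∀ b ∈ h.dom, ‖b‖ ≤ C) {p : V} (hpf : p ∈ f.dom) (hpg : p ∈ g.dom) (hph : p ∈ h.dom) :
    Tendsto (fun k => P (k + 2) - Q (k + 1)) atTop (𝓝 0) ∧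
      Tendsto (fun k => P (k + 2) - R (k + 1)) atTop (𝓝 0) := by
  obtain ⟨JF, hF⟩ := hprox.exists_isProxMap_diag hlam hr
  obtain ⟨JG, hG⟩ := hprox.exists_isProxMap_prod hlam hr
  have hiter := hadmm.drMap_iterate hlam hr hF hG
  have hstep := hadmm.drMap_sub_self hlam hr hF hG
  set S := scaledPair (V := V) hlam hr
  have hlim := drMap_asymptotically_regular hF hG (gapBounded_scaledPair hlam hr hh)
    (x := S (p, p)) (by simpa [ExtFun.comp, ExtFun.diag] using hpf)
    (by simpa [ExtFun.comp, ExtFun.prod] using ⟨hpg, hph⟩) (S (P 1 + B 0, P 1 + D 0))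
  simp only [Function.iterate_succ_apply', hiter, hstep] at hlim
  have hpair : Tendsto (fun k => (P (k + 2) - Q (k + 1), P (k + 2) - R (k + 1))) atTop (𝓝 0) := by
    simpa [S, Function.comp_def] using (S.symm.continuous.tendsto 0).comp hlim
  exact Prod.tendsto_iff _ _ |>.1 hpair

theorem IsConsensusADMM.exists_tendsto (hadmm : IsConsensusADMM f g h lam r P Q R B D)
    (hlam : 0 < lam) (hr : 0 < r) (hprox : HasProxPoints f g h lam r) {C : ℝ}
    (hh : ∀ b ∈ h.dom, ‖b‖ ≤ C) (hslater : ConsensusSlater f g h) :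
    ∃ p ∈ f.dom ∩ (g.dom ∩ h.dom),
      IsMinOn (fun x => f x + (g x + h x)) (f.dom ∩ (g.dom ∩ h.dom)) p ∧
      Tendsto P atTop (𝓝 p) ∧ Tendsto Q atTop (𝓝 p) ∧ Tendsto R atTop (𝓝 p) := by
  obtain ⟨JF, hF⟩ := hprox.exists_isProxMap_diag hlam hr
  obtain ⟨JG, hG⟩ := hprox.exists_isProxMap_prod hlam hr
  have hiter := hadmm.drMap_iterate hlam hr hF hG
  have hshadow := hadmm.proxMap_prod_eq hlam hr hG
  set S := scaledPair (V := V) hlam hr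
  obtain ⟨x, hx, hmin, hlim⟩ := exists_tendsto_drMap_iterate hF hG
    (gapBounded_scaledPair hlam hr hh) (hslater.slaterCondition hlam hr)
    (S (P 1 + B 0, P 1 + D 0))
  obtain ⟨⟨p, q⟩, rfl⟩ := S.surjective x
  obtain ⟨⟨hpf, rfl : q = p⟩, hpg, hph⟩ :
      (p, q) ∈ f.diag.dom ∧ (p, q) ∈ (g.prod h).dom := by simpa [ExtFun.comp] using hx
  simp only [hiter, hshadow] at hlim
  have hQR : Tendsto (fun k => (Q (k + 1), R (k + 1))) atTop (𝓝 (q, q)) := by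
    simpa [S, Function.comp_def] using (S.symm.continuous.tendsto _).comp hlim
  obtain ⟨hQ, hR⟩ := Prod.tendsto_iff _ _ |>.1 hQR
  have hP := (hadmm.tendsto_sub_zero hlam hr hprox hh hpf hpg hph).1.add hQ
  simp only [sub_add_cancel, zero_add] at hP
  refine ⟨q, ⟨hpf, hpg, hph⟩, fun y ⟨hyf, hyg, hyh⟩ => ?_, (tendsto_add_atTop_iff_nat 2).1 hP,
    (tendsto_add_atTop_iff_nat 1).1 hQ, (tendsto_add_atTop_iff_nat 1).1 hR⟩
  simpa [ExtFun.comp, ExtFun.diag, ExtFun.prod] using hmin (a := S (y, y))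
    (by simpa [ExtFun.comp, ExtFun.diag, ExtFun.prod] using ⟨hyf, hyg, hyh⟩)

end Consensus

section FixedPoint

variable {E : Type*} [NormedAddCommGroup E] [InnerProductSpace ℝ E] {Φ : E → E}
  {L : ℝ}

theorem norm_average_sub_sq_le (hmono : ∀ x y, ⟪Φ x - Φ y, x - y⟫ ≤ 0)
    (hlip : ∀ x y, ‖Φ x - Φ y‖ ≤ L * ‖x - y‖) (x y : E) :
    ‖(1 + L ^ 2)⁻¹ • (L ^ 2 • x + Φ x) - (1 + L ^ 2)⁻¹ • (L ^ 2 • y + Φ y)‖ ^ 2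
      ≤ L ^ 2 / (1 + L ^ 2) * ‖x - y‖ ^ 2 := by
  have hdiff : (1 + L ^ 2)⁻¹ • (L ^ 2 • x + Φ x) - (1 + L ^ 2)⁻¹ • (L ^ 2 • y + Φ y)
      = (1 + L ^ 2)⁻¹ • (L ^ 2 • (x - y) + (Φ x - Φ y)) := by module
  have hsq : ‖Φ x - Φ y‖ ^ 2 ≤ L ^ 2 * ‖x - y‖ ^ 2 := by
    rw [← mul_pow]
    exact pow_le_pow_left₀ (norm_nonneg _) (hlip x y) 2
  have hnorm : ‖L ^ 2 • (x - y) + (Φ x - Φ y)‖ ^ 2 ≤ L ^ 2 * (1 + L ^ 2) * ‖x - y‖ ^ 2 := by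
    rw [norm_add_sq_real, norm_smul, Real.norm_eq_abs, mul_pow, sq_abs, real_inner_smul_left,
      real_inner_comm]
    nlinarith [mul_nonneg (sq_nonneg L) (neg_nonneg.2 (hmono x y))]
  rw [hdiff, norm_smul, mul_pow, norm_inv, inv_pow, Real.norm_eq_abs, sq_abs,
    inv_mul_le_iff₀ (by positivity)]
  refine hnorm.trans_eq ?_
  field_simp

/-- A suitable average of `Φ` and the identity is a contraction. -/
theorem exists_fixedPoint_of_antitone [CompleteSpace E]
    (hmono : ∀ x y, ⟪Φ x - Φ y, x - y⟫ ≤ 0)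
    (hlip : ∀ x y, ‖Φ x - Φ y‖ ≤ L * ‖x - y‖) : ∃ z, Φ z = z := by
  set K : NNReal := ⟨√(L ^ 2 / (1 + L ^ 2)), Real.sqrt_nonneg _⟩
  have hcontr : ContractingWith K fun z => (1 + L ^ 2)⁻¹ • (L ^ 2 • z + Φ z) := by
    refine ⟨NNReal.coe_lt_coe.1 ?_, LipschitzWith.of_dist_le_mul fun x y => ?_⟩
    · change √(L ^ 2 / (1 + L ^ 2)) < 1
      rw [Real.sqrt_lt' one_pos, one_pow, div_lt_one (by positivity)]
      linarith
    · rw [dist_eq_norm, dist_eq_norm]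
      refine le_of_sq_le_sq ?_ (by positivity)
      change _ ≤ (√(L ^ 2 / (1 + L ^ 2)) * ‖x - y‖) ^ 2
      rw [mul_pow, Real.sq_sqrt (by positivity)]
      exact norm_average_sub_sq_le hmono hlip x y
  refine ⟨hcontr.fixedPoint, ?_⟩
  have hfix := hcontr.fixedPoint_isFixedPt
  set z := hcontr.fixedPoint
  rw [Function.IsFixedPt, inv_smul_eq_iff₀ (by positivity), add_smul, one_smul, add_comm z] at hfix
  exact add_left_cancel hfix

end FixedPoint

section SymMatrix

/-- Real symmetric matrices, made into a Euclidean space by the trace inner product. This is not an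
abbreviation of the submodule, whose topology would come from the product topology instead. -/
def SymMatrix (ι : Type*) : Type _ :=
  selfAdjoint.submodule ℝ (Matrix ι ι ℝ)

namespace SymMatrix

variable {ι : Type*}

instance : AddCommGroup (SymMatrix ι) :=
  inferInstanceAs (AddCommGroup (selfAdjoint.submodule ℝ (Matrix ι ι ℝ)))

instance : Module ℝ (SymMatrix ι) :=
  inferInstanceAs (Module ℝ (selfAdjoint.submodule ℝ (Matrix ι ι ℝ)))

instance [Finite ι] : FiniteDimensional ℝ (SymMatrix ι) :=
  inferInstanceAs (FiniteDimensional ℝ (selfAdjoint.submodule ℝ (Matrix ι ι ℝ)))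

/-- The underlying matrix. -/
def toMatrix : SymMatrix ι →ₗ[ℝ] Matrix ι ι ℝ :=
  (selfAdjoint.submodule ℝ (Matrix ι ι ℝ)).subtype

instance : CoeOut (SymMatrix ι) (Matrix ι ι ℝ) := ⟨toMatrix⟩

theorem isHermitian (A : SymMatrix ι) : (A : Matrix ι ι ℝ).IsHermitian := A.2

theorem isSymm (A : SymMatrix ι) : (A : Matrix ι ι ℝ).IsSymm := by
  simpa [IsHermitian, IsSymm, conjTranspose_eq_transpose_of_trivial] using A.isHermitian

theorem toMatrix_injective : Function.Injective (toMatrix : SymMatrix ι → Matrix ι ι ℝ) :=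
  Subtype.val_injective

instance : CanLift (Matrix ι ι ℝ) (SymMatrix ι) toMatrix IsSymm where
  prf A hA := ⟨⟨A, (conjTranspose_eq_transpose_of_trivial A).trans hA⟩, rfl⟩

/-- The symmetric part of a matrix, used to regard the iterates of the algorithms as points of
`SymMatrix`. -/
noncomputable def symPart : Matrix ι ι ℝ →ₗ[ℝ] SymMatrix ι :=
  selfAdjointPart ℝ

@[simp]
theorem symPart_coe (A : SymMatrix ι) : symPart (A : Matrix ι ι ℝ) = A :=
  IsSelfAdjoint.selfAdjointPart_apply ℝ A.2

theorem coe_symPart {A : Matrix ι ι ℝ} (hA : A.IsSymm) : (symPart A : Matrix ι ι ℝ) = A := by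
  lift A to SymMatrix ι using hA
  rw [symPart_coe]

variable [Fintype ι]

theorem trace_coe_mul_coe (A B : SymMatrix ι) :
    ((A : Matrix ι ι ℝ) * (B : Matrix ι ι ℝ)).trace
      = ∑ i, ∑ j, (A : Matrix ι ι ℝ) i j * (B : Matrix ι ι ℝ) i j := by
  simp only [trace, diag_apply, mul_apply, B.isSymm.apply]

/-- The trace form of symmetric matrices is an inner product. -/
abbrev innerProductCore : InnerProductSpace.Core ℝ (SymMatrix ι) where
  inner A B := ((A : Matrix ι ι ℝ) * (B : Matrix ι ι ℝ)).trace
  conj_inner_symm A B := trace_mul_comm _ _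
  re_inner_nonneg A := by
    change 0 ≤ ((A : Matrix ι ι ℝ) * (A : Matrix ι ι ℝ)).trace
    rw [trace_coe_mul_coe]
    exact Finset.sum_nonneg fun i _ => Finset.sum_nonneg fun j _ => mul_self_nonneg _
  add_left A B C := by rw [map_add, Matrix.add_mul, trace_add]
  smul_left A B c := by rw [map_smul, Matrix.smul_mul, trace_smul]; rfl
  definite A hA := by
    refine toMatrix_injective ?_
    rw [map_zero, ← trace_conjTranspose_mul_self_eq_zero_iff, A.isHermitian]
    exact hA

noncomputable instance : NormedAddCommGroup (SymMatrix ι) := innerProductCore.toNormedAddCommGroup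

noncomputable instance : InnerProductSpace ℝ (SymMatrix ι) :=
  InnerProductSpace.ofCore innerProductCore.toCore

theorem inner_eq_trace (A B : SymMatrix ι) :
    ⟪A, B⟫ = ((A : Matrix ι ι ℝ) * (B : Matrix ι ι ℝ)).trace :=
  rfl

theorem inner_eq_sum (A B : SymMatrix ι) :
    ⟪A, B⟫ = ∑ i, ∑ j, (A : Matrix ι ι ℝ) i j * (B : Matrix ι ι ℝ) i j :=
  trace_coe_mul_coe A B

theorem continuous_toMatrix : Continuous (toMatrix : SymMatrix ι → Matrix ι ι ℝ) :=
  LinearMap.continuous_of_finiteDimensional toMatrix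

theorem continuous_symPart : Continuous (symPart : Matrix ι ι ℝ → SymMatrix ι) :=
  LinearMap.continuous_of_finiteDimensional symPart

theorem exists_tendsto_of_tendsto_coe {α : Type*} {l : Filter α} [l.NeBot] {Z : α → SymMatrix ι}
    {A : Matrix ι ι ℝ} (hZ : Tendsto (fun a => (Z a : Matrix ι ι ℝ)) l (𝓝 A)) :
    ∃ X : SymMatrix ι, (X : Matrix ι ι ℝ) = A ∧ Tendsto Z l (𝓝 X) := by
  have hX : Tendsto Z l (𝓝 (symPart A)) := by
    simpa only [Function.comp_def, symPart_coe] using (continuous_symPart.tendsto A).comp hZ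
  exact ⟨symPart A, tendsto_nhds_unique ((continuous_toMatrix.tendsto _).comp hX) hZ, hX⟩

variable [DecidableEq ι]

instance : One (SymMatrix ι) := ⟨⟨1, IsSelfAdjoint.one _⟩⟩

@[simp]
theorem coe_one : ((1 : SymMatrix ι) : Matrix ι ι ℝ) = 1 := rfl

theorem inner_one_left (A : SymMatrix ι) : ⟪1, A⟫ = (A : Matrix ι ι ℝ).trace := by
  rw [inner_eq_trace, coe_one, Matrix.one_mul]

theorem inner_one_right (A : SymMatrix ι) : ⟪A, 1⟫ = (A : Matrix ι ι ℝ).trace := by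
  rw [real_inner_comm, inner_one_left]

theorem trace_one_eq_card : ((1 : SymMatrix ι) : Matrix ι ι ℝ).trace = Fintype.card ι := by
  rw [coe_one, trace_one]

omit [DecidableEq ι] in
theorem abs_trace_le (A : SymMatrix ι) :
    |(A : Matrix ι ι ℝ).trace| ≤ Fintype.card ι * ‖A‖ := by
  classical
  have hone : ‖(1 : SymMatrix ι)‖ ≤ Fintype.card ι := by
    refine le_of_sq_le_sq ?_ (Nat.cast_nonneg _)
    rw [← real_inner_self_eq_norm_sq, inner_one_left, trace_one_eq_card]
    exact_mod_cast Nat.le_self_pow two_ne_zero _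
  rw [← inner_one_left]
  exact (abs_real_inner_le_norm 1 A).trans (by gcongr)

end SymMatrix

end SymMatrix

section Spectral

namespace SymMatrix

variable {ι : Type*} [Fintype ι] [DecidableEq ι] {A B X : SymMatrix ι} {f g : ℝ → ℝ} {c : ℝ}

/-- The function `f` of a symmetric matrix, in the sense of the spectral calculus. -/
noncomputable def specMap (f : ℝ → ℝ) (A : SymMatrix ι) : SymMatrix ι :=
  ⟨cfc f (A : Matrix ι ι ℝ), cfc_predicate f (A : Matrix ι ι ℝ)⟩

theorem coe_specMap (f : ℝ → ℝ) (A : SymMatrix ι) :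
    (specMap f A : Matrix ι ι ℝ) = cfc f (A : Matrix ι ι ℝ) := rfl

/-- The eigenvalues of a symmetric matrix. -/
noncomputable def eigenvalue (A : SymMatrix ι) : ι → ℝ :=
  A.isHermitian.eigenvalues

theorem coe_specMap_eq_conj (f : ℝ → ℝ) (A : SymMatrix ι) :
    (specMap f A : Matrix ι ι ℝ)
      = (A.isHermitian.eigenvectorUnitary : Matrix ι ι ℝ) * diagonal (f ∘ A.eigenvalue)
        * (A.isHermitian.eigenvectorUnitary : Matrix ι ι ℝ)ᴴ := by
  rw [coe_specMap, A.isHermitian.cfc_eq, IsHermitian.cfc, Unitary.conjStarAlgAut_apply]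
  rfl

theorem continuousOn_image_spectrum (f g : ℝ → ℝ) (A : SymMatrix ι) :
    ContinuousOn f (g '' spectrum ℝ (A : Matrix ι ι ℝ)) :=
  (finite_real_spectrum.image g).continuousOn f

theorem continuousOn_spectrum (f : ℝ → ℝ) (A : SymMatrix ι) :
    ContinuousOn f (spectrum ℝ (A : Matrix ι ι ℝ)) :=
  finite_real_spectrum.continuousOn f

theorem specMap_id (A : SymMatrix ι) : specMap (fun x => x) A = A :=
  toMatrix_injective (cfc_id' ℝ (A : Matrix ι ι ℝ) A.2)

theorem specMap_one (A : SymMatrix ι) : specMap (fun _ => 1) A = 1 :=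
  toMatrix_injective (cfc_const_one ℝ (A : Matrix ι ι ℝ) A.2)

theorem specMap_specMap (f g : ℝ → ℝ) (A : SymMatrix ι) :
    specMap f (specMap g A) = specMap (fun x => f (g x)) A :=
  toMatrix_injective (cfc_comp' f g (A : Matrix ι ι ℝ) (continuousOn_image_spectrum f g A)
    (continuousOn_spectrum g A) A.2).symm

theorem specMap_add (f g : ℝ → ℝ) (A : SymMatrix ι) :
    specMap (fun x => f x + g x) A = specMap f A + specMap g A :=
  toMatrix_injective
    (cfc_add (A : Matrix ι ι ℝ) f g (continuousOn_spectrum f A) (continuousOn_spectrum g A))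

theorem specMap_sub (f g : ℝ → ℝ) (A : SymMatrix ι) :
    specMap (fun x => f x - g x) A = specMap f A - specMap g A :=
  toMatrix_injective
    (cfc_sub f g (A : Matrix ι ι ℝ) (continuousOn_spectrum f A) (continuousOn_spectrum g A))

theorem specMap_const_mul (c : ℝ) (f : ℝ → ℝ) (A : SymMatrix ι) :
    specMap (fun x => c * f x) A = c • specMap f A :=
  toMatrix_injective (cfc_const_mul c f (A : Matrix ι ι ℝ) (continuousOn_spectrum f A))

theorem inner_specMap_specMap (f g : ℝ → ℝ) (A : SymMatrix ι) :
    ⟪specMap f A, specMap g A⟫ = (specMap (fun x => f x * g x) A : Matrix ι ι ℝ).trace :=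
  congrArg trace
    (cfc_mul f g (A : Matrix ι ι ℝ) (continuousOn_spectrum f A) (continuousOn_spectrum g A)).symm

theorem trace_specMap (f : ℝ → ℝ) (A : SymMatrix ι) :
    (specMap f A : Matrix ι ι ℝ).trace = ∑ i, f (A.eigenvalue i) := by
  have hunitary := Unitary.coe_star_mul_self A.isHermitian.eigenvectorUnitary
  rw [star_eq_conjTranspose] at hunitary
  rw [coe_specMap_eq_conj, trace_mul_comm, ← Matrix.mul_assoc, hunitary, Matrix.one_mul,
    trace_diagonal]
  rfl

/-- The weights are the squared entries of the change of basis between two eigenbases. -/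
theorem exists_inner_specMap_eq_sum (A B : SymMatrix ι) :
    ∃ w : ι → ι → ℝ, (∀ i j, 0 ≤ w i j) ∧ ∀ f g : ℝ → ℝ,
      ⟪specMap f A, specMap g B⟫ = ∑ i, ∑ j, w i j * (f (A.eigenvalue i) * g (B.eigenvalue j)) := by
  set U : Matrix ι ι ℝ := A.isHermitian.eigenvectorUnitary.1
  set V : Matrix ι ι ℝ := B.isHermitian.eigenvectorUnitary.1
  refine ⟨fun i j => ((Uᴴ * V) i j) ^ 2, fun i j => sq_nonneg _, fun f g => ?_⟩
  have hcycle : ⟪specMap f A, specMap g B⟫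
      = (diagonal (f ∘ A.eigenvalue) * (Uᴴ * V) * (diagonal (g ∘ B.eigenvalue)
        * (Uᴴ * V)ᴴ)).trace := by
    rw [inner_eq_trace, coe_specMap_eq_conj, coe_specMap_eq_conj, conjTranspose_mul,
      conjTranspose_conjTranspose]
    simp only [Matrix.mul_assoc]
    rw [trace_mul_comm]
    simp only [Matrix.mul_assoc]
    rfl
  rw [hcycle]
  simp only [trace, diag_apply, mul_apply (M := diagonal _ * (Uᴴ * V)), diagonal_mul,
    conjTranspose_apply, star_trivial, Function.comp_apply]
  exact Finset.sum_congr rfl fun i _ => Finset.sum_congr rfl fun j _ => by ring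

theorem exists_inner_specMap_sub_eq_sum (A B : SymMatrix ι) :
    ∃ w : ι → ι → ℝ, (∀ i j, 0 ≤ w i j) ∧ ∀ f g : ℝ → ℝ,
      ⟪specMap f A - specMap f B, specMap g A - specMap g B⟫
        = ∑ i, ∑ j, w i j * ((f (A.eigenvalue i) - f (B.eigenvalue j))
          * (g (A.eigenvalue i) - g (B.eigenvalue j))) := by
  obtain ⟨w, hw_nonneg, hw⟩ := exists_inner_specMap_eq_sum A B
  refine ⟨w, hw_nonneg, fun f g => ?_⟩
  have hAA : ⟪specMap f A, specMap g A⟫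
      = ⟪specMap (fun x => f x * g x) A, specMap (fun _ => 1) B⟫ := by
    rw [inner_specMap_specMap, specMap_one, inner_one_right]
  have hBB : ⟪specMap f B, specMap g B⟫
      = ⟪specMap (fun _ => 1) A, specMap (fun x => f x * g x) B⟫ := by
    rw [inner_specMap_specMap, specMap_one, inner_one_left]
  rw [inner_sub_left, inner_sub_right, inner_sub_right, hAA, hBB,
    real_inner_comm (specMap g A) (specMap f B), hw, hw, hw, hw]
  simp only [← Finset.sum_sub_distrib]
  exact Finset.sum_congr rfl fun i _ => Finset.sum_congr rfl fun j _ => by ring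

theorem norm_specMap_sub_le {L : ℝ} (hL : 0 ≤ L) (hf : ∀ x y, |f x - f y| ≤ L * |x - y|)
    (A B : SymMatrix ι) : ‖specMap f A - specMap f B‖ ≤ L * ‖A - B‖ := by
  obtain ⟨w, hw_nonneg, hw⟩ := exists_inner_specMap_sub_eq_sum A B
  have hid := hw (fun x => x) fun x => x
  rw [specMap_id, specMap_id, real_inner_self_eq_norm_sq] at hid
  refine le_of_sq_le_sq ?_ (by positivity)
  rw [mul_pow, hid, ← real_inner_self_eq_norm_sq, hw, Finset.mul_sum]
  refine Finset.sum_le_sum fun i _ => ?_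
  rw [Finset.mul_sum]
  refine Finset.sum_le_sum fun j _ => ?_
  have hsq := mul_self_le_mul_self (abs_nonneg _) (hf (A.eigenvalue i) (B.eigenvalue j))
  rw [abs_mul_abs_self, mul_mul_mul_comm, abs_mul_abs_self] at hsq
  linarith [mul_le_mul_of_nonneg_left hsq (hw_nonneg i j)]

theorem inner_specMap_sub_nonpos (hf : Antitone f) (A B : SymMatrix ι) :
    ⟪specMap f A - specMap f B, A - B⟫ ≤ 0 := by
  obtain ⟨w, hw_nonneg, hw⟩ := exists_inner_specMap_sub_eq_sum A B
  have hsum := hw f fun x => x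
  rw [specMap_id, specMap_id] at hsum
  rw [hsum]
  refine Finset.sum_nonpos fun i _ => Finset.sum_nonpos fun j _ =>
    mul_nonpos_of_nonneg_of_nonpos (hw_nonneg i j) ?_
  rcases le_total (A.eigenvalue i) (B.eigenvalue j) with h | h
  · exact mul_nonpos_of_nonneg_of_nonpos (sub_nonneg.2 (hf h)) (sub_nonpos.2 h)
  · exact mul_nonpos_of_nonpos_of_nonneg (sub_nonpos.2 (hf h)) (sub_nonneg.2 h)

theorem trace_specMap_comp_le {φ ψ g : ℝ → ℝ} {s : Set ℝ} (hX : ∀ i, X.eigenvalue i ∈ s)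
    (hψ : ∀ a, ∀ x ∈ s, ψ (φ a) + g a * (x - φ a) ≤ ψ x) (A : SymMatrix ι) :
    (specMap ψ (specMap φ A) : Matrix ι ι ℝ).trace + ⟪specMap g A, X - specMap φ A⟫
      ≤ (specMap ψ X : Matrix ι ι ℝ).trace := by
  obtain ⟨w, hw_nonneg, hw⟩ := exists_inner_specMap_eq_sum A X
  have hleft : (specMap ψ (specMap φ A) : Matrix ι ι ℝ).trace
      = ⟪specMap (fun a => ψ (φ a)) A, specMap (fun _ => 1) X⟫ := by
    rw [specMap_one, inner_one_right, specMap_specMap]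
  have hcross : ⟪specMap g A, specMap φ A⟫
      = ⟪specMap (fun a => g a * φ a) A, specMap (fun _ => 1) X⟫ := by
    rw [inner_specMap_specMap, specMap_one, inner_one_right]
  have hright : (specMap ψ X : Matrix ι ι ℝ).trace
      = ⟪specMap (fun _ => 1) A, specMap ψ X⟫ := by rw [specMap_one, inner_one_left]
  have hlin : ⟪specMap g A, X⟫ = ⟪specMap g A, specMap (fun x => x) X⟫ := by rw [specMap_id]
  rw [inner_sub_right, hleft, hcross, hright, hlin, hw, hw, hw, hw]
  simp only [← Finset.sum_sub_distrib, ← Finset.sum_add_distrib]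
  refine Finset.sum_le_sum fun i _ => Finset.sum_le_sum fun j _ => ?_
  linarith [mul_le_mul_of_nonneg_left (hψ (A.eigenvalue i) _ (hX j)) (hw_nonneg i j)]

theorem posSemidef_specMap (hf : ∀ i, 0 ≤ f (A.eigenvalue i)) :
    (specMap f A : Matrix ι ι ℝ).PosSemidef := by
  rw [coe_specMap_eq_conj]
  exact (PosSemidef.diagonal hf).mul_mul_conjTranspose_same _

theorem abs_eigenvalue_le_norm (A : SymMatrix ι) (i : ι) : |A.eigenvalue i| ≤ ‖A‖ := by
  refine abs_le_of_sq_le_sq ?_ (norm_nonneg A)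
  have hnorm := inner_specMap_specMap (fun x => x) (fun x => x) A
  rw [specMap_id, real_inner_self_eq_norm_sq, trace_specMap] at hnorm
  rw [hnorm, sq]
  exact Finset.single_le_sum (f := fun i => A.eigenvalue i * A.eigenvalue i)
    (fun j _ => mul_self_nonneg _) (Finset.mem_univ i)

theorem posSemidef_smul_one_add (hA : ‖A‖ ≤ c) :
    ((c • 1 + A : SymMatrix ι) : Matrix ι ι ℝ).PosSemidef := by
  have hspec : c • 1 + A = specMap (fun x => c * 1 + x) A := by
    rw [specMap_add, specMap_const_mul, specMap_one, specMap_id]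
  rw [hspec]
  exact posSemidef_specMap fun i => by
    linarith [neg_le_of_abs_le ((abs_eigenvalue_le_norm A i).trans hA)]

end SymMatrix

end Spectral

section SpectralBox

namespace SymMatrix

variable {ι : Type*} [Fintype ι] [DecidableEq ι] {A X : SymMatrix ι} {f : ℝ → ℝ} {c : ℝ}

/-- The symmetric matrices `0 ⪯ X ⪯ I`. -/
def spectralBox (ι : Type*) [DecidableEq ι] : Set (SymMatrix ι) :=
  {X | (X : Matrix ι ι ℝ).PosSemidef ∧ ((1 : Matrix ι ι ℝ) - X).PosSemidef}

theorem eigenvalue_mem_Icc (hX : X ∈ spectralBox ι) (i : ι) : X.eigenvalue i ∈ Set.Icc 0 1 := by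
  refine ⟨hX.1.eigenvalues_nonneg i, ?_⟩
  set v := X.isHermitian.eigenvectorBasis i
  have hnorm : star v.ofLp ⬝ᵥ v.ofLp = 1 := by
    rw [dotProduct_comm, ← EuclideanSpace.inner_eq_star_dotProduct, real_inner_self_eq_norm_sq,
      X.isHermitian.eigenvectorBasis.orthonormal.1 i, one_pow]
  have hquad := hX.2.dotProduct_mulVec_nonneg v.ofLp
  rw [sub_mulVec, one_mulVec, X.isHermitian.mulVec_eigenvectorBasis, dotProduct_sub, hnorm,
    dotProduct_smul, hnorm, smul_eq_mul, mul_one] at hquad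
  exact sub_nonneg.1 hquad

theorem specMap_mem_spectralBox (hf : ∀ x, f x ∈ Set.Icc 0 1) (A : SymMatrix ι) :
    specMap f A ∈ spectralBox ι := by
  refine ⟨posSemidef_specMap fun i => (hf _).1, ?_⟩
  have hsub : (1 : Matrix ι ι ℝ) - specMap f A = (specMap (fun x => 1 - f x) A : SymMatrix ι) := by
    rw [specMap_sub, specMap_one, map_sub, coe_one]
  rw [hsub]
  exact posSemidef_specMap fun i => sub_nonneg.2 (hf _).2

theorem one_sub_mem_spectralBox (hX : X ∈ spectralBox ι) : 1 - X ∈ spectralBox ι := by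
  rw [spectralBox, Set.mem_ofPred_eq, map_sub, coe_one, sub_sub_cancel]
  exact hX.symm

theorem smul_one_add_mem_spectralBox (hA : ‖A‖ ≤ c) (hA' : ‖A‖ ≤ 1 - c) :
    c • 1 + A ∈ spectralBox ι := by
  refine ⟨posSemidef_smul_one_add hA, ?_⟩
  have hsub : (1 : Matrix ι ι ℝ) - (c • 1 + A : SymMatrix ι)
      = ((1 - c) • 1 + -A : SymMatrix ι) := by
    rw [← coe_one, ← map_sub]
    congr 1
    module
  rw [hsub]
  exact posSemidef_smul_one_add (by rwa [norm_neg])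

theorem trace_eq_sum_eigenvalue (A : SymMatrix ι) :
    (A : Matrix ι ι ℝ).trace = ∑ i, A.eigenvalue i := by
  conv_lhs => rw [← specMap_id A]
  exact trace_specMap _ A

theorem norm_sq_le_trace (hX : X ∈ spectralBox ι) : ‖X‖ ^ 2 ≤ (X : Matrix ι ι ℝ).trace := by
  have hnorm := inner_specMap_specMap (fun x => x) (fun x => x) X
  rw [specMap_id, real_inner_self_eq_norm_sq, trace_specMap] at hnorm
  rw [hnorm, trace_eq_sum_eigenvalue]
  exact Finset.sum_le_sum fun i _ =>
    mul_le_of_le_one_left (eigenvalue_mem_Icc hX i).1 (eigenvalue_mem_Icc hX i).2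

theorem norm_le_sqrt_card (hX : X ∈ spectralBox ι) : ‖X‖ ≤ √(Fintype.card ι) := by
  refine Real.le_sqrt_of_sq_le ((norm_sq_le_trace hX).trans ?_)
  have hsub := (one_sub_mem_spectralBox hX).1.trace_nonneg
  rwa [map_sub, trace_sub, trace_one_eq_card, sub_nonneg] at hsub

/-- The convex indicator function of the spectral box. -/
def boxIndicator (ι : Type*) [DecidableEq ι] : ExtFun (SymMatrix ι) where
  dom := spectralBox ι
  toFun := 0

theorem isProxAt_boxIndicator (hc : 0 ≤ c) (A : SymMatrix ι) :
    IsProxAt (boxIndicator ι) c A (specMap (fun x => min (max x 0) 1) A) := by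
  refine ⟨specMap_mem_spectralBox
    (fun x => ⟨le_min (le_max_right x 0) zero_le_one, min_le_right _ _⟩) A, fun X hX => ?_⟩
  have hscalar : ∀ a, ∀ x ∈ Set.Icc (0 : ℝ) 1,
      0 + (a - min (max a 0) 1) * (x - min (max a 0) 1) ≤ 0 := by
    rintro a x ⟨hx0, hx1⟩
    rcases le_total a 0 with ha | ha
    · rw [max_eq_right ha, min_eq_left zero_le_one]
      nlinarith
    · rw [max_eq_left ha]
      rcases le_total a 1 with ha' | ha'
      · rw [min_eq_left ha', sub_self, zero_mul, zero_add]
      · rw [min_eq_right ha']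
        nlinarith
  have htrace := trace_specMap_comp_le (ψ := fun _ => 0) (eigenvalue_mem_Icc hX) hscalar A
  rw [specMap_sub, specMap_id, trace_specMap, trace_specMap] at htrace
  simp only [Finset.sum_const_zero, zero_add] at htrace
  simpa [boxIndicator] using mul_nonpos_of_nonneg_of_nonpos hc htrace

end SymMatrix

end SpectralBox

section TraceSlice

namespace SymMatrix

variable {n N : ℕ} {c : ℝ} {X : SymMatrix (Fin n)}

/-- The symmetric matrices of trace `N`. -/
def traceSlice (n N : ℕ) : Set (SymMatrix (Fin n)) :=
  {X | (X : Matrix (Fin n) (Fin n) ℝ).trace = N}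

theorem convex_traceSlice : Convex ℝ (traceSlice n N) := by
  intro X hX Y hY a b _ _ hab
  simp only [traceSlice, Set.mem_ofPred_eq] at hX hY ⊢
  rw [map_add, map_smul, map_smul, trace_add, trace_smul, trace_smul, hX, hY, ← add_smul, hab,
    one_smul]

theorem coe_mem_feasible_iff :
    (X : Matrix (Fin n) (Fin n) ℝ) ∈ feasible n N ↔ X ∈ spectralBox (Fin n) ∩ traceSlice n N :=
  ⟨fun ⟨_, htrace, hbox⟩ => ⟨hbox, htrace⟩, fun ⟨hbox, htrace⟩ => ⟨X.isSymm, htrace, hbox⟩⟩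

/-- The orthogonal projection onto the matrices of trace `N`; for `n = 0` it is the identity, as
division by zero gives zero. -/
noncomputable def traceProj (N : ℕ) (X : SymMatrix (Fin n)) : SymMatrix (Fin n) :=
  X - (((X : Matrix (Fin n) (Fin n) ℝ).trace - N) / n) • 1

theorem traceProj_mem_traceSlice (hN : N ≤ n) (X : SymMatrix (Fin n)) :
    traceProj N X ∈ traceSlice n N := by
  rw [traceSlice, Set.mem_ofPred_eq, traceProj, map_sub, map_smul, trace_sub, trace_smul,
    trace_one_eq_card, Fintype.card_fin, smul_eq_mul]
  rcases n.eq_zero_or_pos with rfl | hn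
  · simp [Nat.le_zero.1 hN]
  · field_simp
    ring

theorem traceProj_zero : traceProj N (0 : SymMatrix (Fin n)) = ((N : ℝ) / n) • 1 := by
  rw [traceProj, map_zero, trace_zero, zero_sub, zero_sub, neg_div, neg_smul, neg_neg]

theorem traceProj_sub_self (X : SymMatrix (Fin n)) :
    traceProj N X - X = ((N - (X : Matrix (Fin n) (Fin n) ℝ).trace) / n) • 1 := by
  rw [traceProj, sub_sub_cancel_left, ← neg_smul, ← neg_div, neg_sub]

/-- The function `X ↦ tr (H X)` on the matrices of trace `N`. -/
noncomputable def linearOnSlice (N : ℕ) (H : SymMatrix (Fin n)) : ExtFun (SymMatrix (Fin n)) where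
  dom := traceSlice n N
  toFun X := ⟪H, X⟫

theorem isProxAt_linearOnSlice (hN : N ≤ n) (hc : c ≠ 0) (H w : SymMatrix (Fin n)) :
    IsProxAt (linearOnSlice N H) c w (traceProj N (w - c⁻¹ • H)) := by
  have hmem := traceProj_mem_traceSlice hN (w - c⁻¹ • H)
  refine ⟨hmem, fun X hX => le_of_eq ?_⟩
  set p := traceProj N (w - c⁻¹ • H) with hp
  obtain ⟨t, ht⟩ : ∃ t : ℝ, w - p = c⁻¹ • H + t • 1 := ⟨_, by rw [hp, traceProj]; abel⟩
  have htrace : ⟪1, X - p⟫ = 0 := by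
    rw [inner_one_left, map_sub, trace_sub, hX, hmem, sub_self]
  simp only [linearOnSlice]
  rw [ht, inner_add_left, real_inner_smul_left, real_inner_smul_left, htrace, mul_zero, add_zero,
    mul_inv_cancel_left₀ hc, inner_sub_right]
  ring

theorem smul_one_mem_spectralBox_inter_traceSlice (hN : N ≤ n) :
    ((N : ℝ) / n) • 1 ∈ spectralBox (Fin n) ∩ traceSlice n N := by
  refine ⟨?_, traceProj_zero (n := n) ▸ traceProj_mem_traceSlice hN 0⟩
  have hmem := smul_one_add_mem_spectralBox (A := (0 : SymMatrix (Fin n))) (c := (N : ℝ) / n)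
    (by rw [norm_zero]; positivity)
    (by rw [norm_zero, sub_nonneg]; exact div_le_one_of_le₀ (by exact_mod_cast hN) (by positivity))
  rwa [add_zero] at hmem

/-- In the two degenerate cases the feasible set is the single point `(N / n) • 1`. -/
theorem norm_sub_smul_one_sq_le (hN : N = 0 ∨ N = n) (hX : X ∈ spectralBox (Fin n)) :
    ‖X - ((N : ℝ) / n) • 1‖ ^ 2 ≤ |(X : Matrix (Fin n) (Fin n) ℝ).trace - N| := by
  rcases N.eq_zero_or_pos with rfl | hpos
  · simpa using (norm_sq_le_trace hX).trans (le_abs_self _)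
  · obtain rfl : N = n := hN.resolve_left hpos.ne'
    rw [div_self (by positivity), one_smul, norm_sub_rev, abs_sub_comm]
    refine (norm_sq_le_trace (one_sub_mem_spectralBox hX)).trans ?_
    rw [map_sub, trace_sub, trace_one_eq_card, Fintype.card_fin]
    exact le_abs_self _

end SymMatrix

end TraceSlice

section BoxSplitting

open SymMatrix

variable {n N : ℕ} {lam r : ℝ} {f g : ExtFun (SymMatrix (Fin n))}
  {P Q R B D : ℕ → SymMatrix (Fin n)}

/-- A splitting of an energy on the feasible set as `f + g + boxIndicator`, to which the
alternating direction method applies; the trace constraint may be carried by either of `f`, `g`. -/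
structure IsBoxSplitting (N : ℕ) (f g : ExtFun (SymMatrix (Fin n))) (lam r : ℝ) : Prop where
  prox : HasProxPoints f g (boxIndicator (Fin n)) lam r
  inter_dom : f.dom ∩ (g.dom ∩ spectralBox (Fin n)) = spectralBox (Fin n) ∩ traceSlice n N
  dom_subset : f.dom ⊆ traceSlice n N ∨ g.dom ⊆ traceSlice n N
  slater : 0 < N → N < n → ConsensusSlater f g (boxIndicator (Fin n))

theorem IsBoxSplitting.tendsto_smul_one (hsplit : IsBoxSplitting N f g lam r)
    (hadmm : IsConsensusADMM f g (boxIndicator (Fin n)) lam r P Q R B D) (hlam : 0 < lam)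
    (hr : 0 < r) (hN : N ≤ n) (hdeg : N = 0 ∨ N = n) :
    Tendsto P atTop (𝓝 (((N : ℝ) / n) • 1)) ∧ Tendsto Q atTop (𝓝 (((N : ℝ) / n) • 1)) ∧
      Tendsto R atTop (𝓝 (((N : ℝ) / n) • 1)) := by
  obtain ⟨hone_f, hone_g, hone_h⟩ :=
    hsplit.inter_dom.symm ▸ smul_one_mem_spectralBox_inter_traceSlice hN
  obtain ⟨hPQ, hPR⟩ := hadmm.tendsto_sub_zero hlam hr hsplit.prox
    (fun X hX => norm_le_sqrt_card hX) hone_f hone_g hone_h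
  obtain ⟨T, hT, hTR⟩ : ∃ T : ℕ → SymMatrix (Fin n), (∀ k, T k ∈ traceSlice n N) ∧
      Tendsto (fun k => T k - R (k + 1)) atTop (𝓝 0) := by
    rcases hsplit.dom_subset with hf | hg
    · exact ⟨fun k => P (k + 2), fun k => hf (hadmm.P_prox _).1, hPR⟩
    · refine ⟨fun k => Q (k + 1), fun k => hg (hadmm.Q_prox _).1, ?_⟩
      simpa using hPR.sub hPQ
  have htrace : Tendsto (fun k => |⟪1, T k - R (k + 1)⟫|) atTop (𝓝 0) :=
    squeeze_zero (fun k => abs_nonneg _) (fun k => abs_real_inner_le_norm _ _)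
      (by simpa using hTR.norm.const_mul ‖(1 : SymMatrix (Fin n))‖)
  have hR_sq : Tendsto (fun k => ‖R (k + 1) - ((N : ℝ) / n) • 1‖ ^ 2) atTop (𝓝 0) := by
    refine squeeze_zero (fun k => sq_nonneg _) (fun k => ?_) htrace
    rw [inner_one_left, map_sub, trace_sub, hT k, abs_sub_comm]
    exact norm_sub_smul_one_sq_le hdeg (hadmm.R_prox k).1
  have hR : Tendsto (fun k => R (k + 1)) atTop (𝓝 (((N : ℝ) / n) • 1)) := by
    refine tendsto_iff_norm_sub_tendsto_zero.2 ?_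
    simpa using hR_sq.sqrt
  have hP : Tendsto (fun k => P (k + 2)) atTop (𝓝 (((N : ℝ) / n) • 1)) := by
    simpa using hPR.add hR
  have hQ : Tendsto (fun k => Q (k + 1)) atTop (𝓝 (((N : ℝ) / n) • 1)) := by
    simpa using hP.sub hPQ
  exact ⟨(tendsto_add_atTop_iff_nat 2).1 hP, (tendsto_add_atTop_iff_nat 1).1 hQ,
    (tendsto_add_atTop_iff_nat 1).1 hR⟩

theorem IsBoxSplitting.exists_tendsto (hsplit : IsBoxSplitting N f g lam r)
    (hadmm : IsConsensusADMM f g (boxIndicator (Fin n)) lam r P Q R B D) (hlam : 0 < lam)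
    (hr : 0 < r) (hN : N ≤ n) :
    ∃ p ∈ spectralBox (Fin n) ∩ traceSlice n N,
      IsMinOn (fun X => f X + g X) (spectralBox (Fin n) ∩ traceSlice n N) p ∧
      Tendsto P atTop (𝓝 p) ∧ Tendsto Q atTop (𝓝 p) ∧ Tendsto R atTop (𝓝 p) := by
  by_cases hdeg : N = 0 ∨ N = n
  · refine ⟨_, smul_one_mem_spectralBox_inter_traceSlice hN, fun X hX => ?_,
      hsplit.tendsto_smul_one hadmm hlam hr hN hdeg⟩
    have hX_eq : ‖X - ((N : ℝ) / n) • 1‖ ^ 2 ≤ 0 := by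
      simpa only [hX.2.out, sub_self, abs_zero] using norm_sub_smul_one_sq_le hdeg hX.1
    obtain rfl : X = ((N : ℝ) / n) • 1 := by
      simpa [sub_eq_zero] using hX_eq.antisymm (sq_nonneg _)
    exact le_refl (f _ + g _)
  · push Not at hdeg
    obtain ⟨p, hp, hmin, hconv⟩ := hadmm.exists_tendsto hlam hr hsplit.prox
      (fun X hX => norm_le_sqrt_card hX)
      (hsplit.slater (Nat.pos_of_ne_zero hdeg.1) (hN.lt_of_ne hdeg.2))
    rw [boxIndicator, hsplit.inter_dom] at hp hmin
    exact ⟨p, hp, by simpa using hmin, hconv⟩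

end BoxSplitting

section EntrywiseL1

variable {n N : ℕ} {η lam : ℝ}

theorem mul_abs_shrink_add_le {t : ℝ} (ht : 0 ≤ t) (x y : ℝ) :
    t * |shrink x t| + (x - shrink x t) * (y - shrink x t) ≤ t * |y| := by
  have hy := le_abs_self y
  have hy' := neg_abs_le y
  rw [shrink]
  rcases le_total (|x| - t) 0 with hsmall | hlarge
  · rw [max_eq_right hsmall, mul_zero, abs_zero, mul_zero, sub_zero, sub_zero, zero_add]
    calc x * y ≤ |x| * |y| := (le_abs_self _).trans (abs_mul x y).le
      _ ≤ t * |y| := by gcongr; linarith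
  · rw [max_eq_left hlarge]
    rcases lt_trichotomy x 0 with hx | rfl | hx
    · rw [Real.sign_of_neg hx, abs_mul, abs_of_nonneg hlarge, abs_neg, abs_one, abs_of_neg hx]
      nlinarith
    · simpa using mul_nonneg ht (abs_nonneg y)
    · rw [Real.sign_of_pos hx, abs_mul, abs_of_nonneg hlarge, abs_one, abs_of_pos hx]
      nlinarith

theorem div_mul_abs_shrink_add_le (hη : 0 < η) (hlam : 0 < lam) (x y : ℝ) :
    1 / η * |shrink x (1 / (lam * η))|
      + lam * ((x - shrink x (1 / (lam * η))) * (y - shrink x (1 / (lam * η)))) ≤ 1 / η * |y| := by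
  have h := mul_le_mul_of_nonneg_left
    (mul_abs_shrink_add_le (t := 1 / (lam * η)) (by positivity) x y) hlam.le
  have hscale : lam * (1 / (lam * η)) = 1 / η := by field_simp
  rwa [mul_add, ← mul_assoc, ← mul_assoc lam (1 / (lam * η)) |y|, hscale] at h

theorem shrink_isMinOn (hη : 0 < η) (hlam : 0 < lam) (x : ℝ) :
    IsMinOn (fun y => 1 / η * |y| + lam / 2 * (y - x) ^ 2) Set.univ
      (shrink x (1 / (lam * η))) := fun y _ => by
  have h := div_mul_abs_shrink_add_le hη hlam x y
  have hsq := mul_nonneg hlam.le (sq_nonneg (y - shrink x (1 / (lam * η))))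
  simp only [Set.mem_ofPred_eq]
  linarith

theorem dist_sq_le_sum_sq (v m : Fin n → ℝ) : dist v m ^ 2 ≤ ∑ i, (v i - m i) ^ 2 := by
  refine (Real.le_sqrt dist_nonneg (by positivity)).1
    ((dist_pi_le_iff (Real.sqrt_nonneg _)).2 fun i => Real.abs_le_sqrt ?_)
  exact Finset.single_le_sum (f := fun i => (v i - m i) ^ 2) (fun _ _ => sq_nonneg _)
    (Finset.mem_univ i)

theorem exists_isDiagUpdate (hN : N ≤ n) (hη : 0 < η) (hlam : 0 < lam) (m : Fin n → ℝ) :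
    ∃ q, IsDiagUpdate N η lam m q := by
  obtain ⟨v₀, hv₀⟩ : ∃ v : Fin n → ℝ, ∑ i, v i = N := by
    refine ⟨fun _ => N / n, ?_⟩
    rw [Finset.sum_const, Finset.card_univ, Fintype.card_fin, nsmul_eq_mul]
    exact mul_div_cancel_of_imp' fun hn => by
      rw [Nat.cast_eq_zero] at hn ⊢
      exact Nat.le_zero.1 (hn ▸ hN)
  have hcoercive : Tendsto (fun v : Fin n → ℝ => lam / 2 * dist v m ^ 2) (cocompact _) atTop :=
    ((tendsto_pow_atTop two_ne_zero).comp
      (tendsto_dist_right_cocompact_atTop m)).const_mul_atTop (by positivity)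
  refine ContinuousOn.exists_isMinOn' (Continuous.continuousOn (by fun_prop))
    (isClosed_eq (by fun_prop) (by fun_prop)) hv₀ (Filter.Eventually.filter_mono inf_le_left ?_)
  filter_upwards [hcoercive.eventually_ge_atTop
    (1 / η * ∑ i, |v₀ i| + lam / 2 * ∑ i, (v₀ i - m i) ^ 2)] with v hv
  have hl1 : 0 ≤ 1 / η * ∑ i, |v i| := by positivity
  calc _ ≤ _ := hv
    _ ≤ lam / 2 * ∑ i, (v i - m i) ^ 2 := by gcongr; exact dist_sq_le_sum_sq v m
    _ ≤ _ := le_add_of_nonneg_left hl1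

theorem exists_shrink_offDiag_isDiagUpdate (hN : N ≤ n) (hη : 0 < η) (hlam : 0 < lam)
    (M : Matrix (Fin n) (Fin n) ℝ) :
    ∃ Q : Matrix (Fin n) (Fin n) ℝ, (∀ i j, i ≠ j → Q i j = shrink (M i j) (lam * η)⁻¹) ∧
      IsDiagUpdate N η lam M.diag Q.diag := by
  obtain ⟨q, hq⟩ := exists_isDiagUpdate hN hη hlam M.diag
  refine ⟨Matrix.of fun i j => if i = j then q i else shrink (M i j) (lam * η)⁻¹,
    fun i j hij => if_neg hij, ?_⟩
  convert hq using 1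
  ext i
  exact if_pos rfl

theorem isSymm_of_offDiag_eq {ι : Type*} {M Q : Matrix ι ι ℝ} {φ : ℝ → ℝ} (hM : M.IsSymm)
    (hoff : ∀ i j, i ≠ j → Q i j = φ (M i j)) : Q.IsSymm := by
  refine IsSymm.ext fun i j => ?_
  rcases eq_or_ne i j with rfl | hij
  · rfl
  · rw [hoff i j hij, hoff j i hij.symm, hM.apply]

namespace SymMatrix

variable {M Q X : SymMatrix (Fin n)}

theorem norm_sq_eq_sum (X : SymMatrix (Fin n)) :
    ‖X‖ ^ 2 = ∑ i, ∑ j, (X : Matrix (Fin n) (Fin n) ℝ) i j ^ 2 := by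
  rw [← real_inner_self_eq_norm_sq, inner_eq_sum]
  simp only [sq]

theorem entrywiseL1_le (X : SymMatrix (Fin n)) :
    entrywiseL1 (X : Matrix (Fin n) (Fin n) ℝ) ≤ n * ‖X‖ := by
  refine le_of_sq_le_sq ?_ (by positivity)
  rw [mul_pow, norm_sq_eq_sum, entrywiseL1, ← Fintype.sum_prod_type', ← Fintype.sum_prod_type']
  refine sq_sum_le_card_mul_sum_sq.trans (le_of_eq ?_)
  simp [sq]

/-- The function `η⁻¹ ‖X‖₁` restricted to the set `s`. -/
noncomputable def l1On (s : Set (SymMatrix (Fin n))) (η : ℝ) : ExtFun (SymMatrix (Fin n)) where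
  dom := s
  toFun X := 1 / η * entrywiseL1 (X : Matrix (Fin n) (Fin n) ℝ)

theorem convexOn_l1On {s : Set (SymMatrix (Fin n))} (hs : Convex ℝ s) (hη : 0 < η) :
    ConvexOn ℝ s (l1On s η) := by
  refine ⟨hs, fun X _ Y _ a b ha hb _ => ?_⟩
  simp only [l1On, entrywiseL1, map_add, map_smul, Finset.mul_sum, smul_eq_mul, Matrix.add_apply,
    Matrix.smul_apply, ← Finset.sum_add_distrib]
  refine Finset.sum_le_sum fun i _ => Finset.sum_le_sum fun j _ => ?_
  rw [mul_left_comm a, mul_left_comm b, ← mul_add]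
  gcongr
  refine (abs_add_le _ _).trans_eq ?_
  rw [abs_mul, abs_mul, abs_of_nonneg ha, abs_of_nonneg hb]

theorem l1On_add_eq_sum (s : Set (SymMatrix (Fin n))) (η lam : ℝ) (X M : SymMatrix (Fin n)) :
    l1On s η X + lam / 2 * ‖X - M‖ ^ 2
      = ∑ i, ∑ j, (1 / η * |(X : Matrix (Fin n) (Fin n) ℝ) i j|
        + lam / 2 * ((X : Matrix (Fin n) (Fin n) ℝ) i j
          - (M : Matrix (Fin n) (Fin n) ℝ) i j) ^ 2) := by
  simp only [l1On, entrywiseL1, norm_sq_eq_sum, map_sub, Matrix.sub_apply, Finset.mul_sum,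
    Finset.sum_add_distrib]

theorem isProxAt_l1On_univ (hη : 0 < η) (hlam : 0 < lam)
    (hQ : ∀ i j, (Q : Matrix (Fin n) (Fin n) ℝ) i j
      = shrink ((M : Matrix (Fin n) (Fin n) ℝ) i j) (1 / (lam * η))) :
    IsProxAt (l1On Set.univ η) lam M Q := by
  refine isProxAt_of_isMinOn (convexOn_l1On convex_univ hη) trivial fun X _ => ?_
  simp only [Set.mem_ofPred_eq, l1On_add_eq_sum, hQ]
  exact Finset.sum_le_sum fun i _ => Finset.sum_le_sum fun j _ =>
    shrink_isMinOn hη hlam _ (Set.mem_univ _)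

theorem isProxAt_l1On_traceSlice (hη : 0 < η) (hlam : 0 < lam)
    (hoff : ∀ i j, i ≠ j → (Q : Matrix (Fin n) (Fin n) ℝ) i j
      = shrink ((M : Matrix (Fin n) (Fin n) ℝ) i j) (lam * η)⁻¹)
    (hdiag : IsDiagUpdate N η lam (M : Matrix (Fin n) (Fin n) ℝ).diag
      (Q : Matrix (Fin n) (Fin n) ℝ).diag) :
    IsProxAt (l1On (traceSlice n N) η) lam M Q := by
  refine isProxAt_of_isMinOn (convexOn_l1On convex_traceSlice hη) hdiag.1 fun X hX => ?_
  simp only [Set.mem_ofPred_eq, l1On_add_eq_sum]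
  rw [← sub_nonneg]
  simp only [← Finset.sum_sub_distrib]
  have hdiag_le := hdiag.2 (show (X : Matrix (Fin n) (Fin n) ℝ).diag ∈ _ from hX)
  simp only [Set.mem_ofPred_eq, Finset.mul_sum, ← Finset.sum_add_distrib, diag_apply] at hdiag_le
  rw [← sub_nonneg, ← Finset.sum_sub_distrib] at hdiag_le
  refine hdiag_le.trans (Finset.sum_le_sum fun i _ => ?_)
  rw [← Finset.add_sum_erase _ _ (Finset.mem_univ i)]
  refine le_add_of_nonneg_right (Finset.sum_nonneg fun j hj => sub_nonneg.2 ?_)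
  rw [hoff i j (Finset.ne_of_mem_erase hj).symm, ← one_div]
  exact shrink_isMinOn hη hlam _ (Set.mem_univ _)

theorem exists_isProxAt_l1On_univ (hη : 0 < η) (hlam : 0 < lam) (M : SymMatrix (Fin n)) :
    ∃ Q, IsProxAt (l1On Set.univ η) lam M Q := by
  have hsymm := M.isSymm.map fun x => shrink x (1 / (lam * η))
  exact ⟨symPart _, isProxAt_l1On_univ hη hlam fun i j => by rw [coe_symPart hsymm, map_apply]⟩

theorem exists_isProxAt_l1On_traceSlice (hN : N ≤ n) (hη : 0 < η) (hlam : 0 < lam)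
    (M : SymMatrix (Fin n)) : ∃ Q, IsProxAt (l1On (traceSlice n N) η) lam M Q := by
  obtain ⟨Q, hoff, hdiag⟩ :=
    exists_shrink_offDiag_isDiagUpdate hN hη hlam (M : Matrix (Fin n) (Fin n) ℝ)
  lift Q to SymMatrix (Fin n) using
    isSymm_of_offDiag_eq (φ := fun x => shrink x (lam * η)⁻¹) M.isSymm hoff
  exact ⟨Q, isProxAt_l1On_traceSlice hη hlam hoff hdiag⟩

theorem consensusSlater_l1On {f : ExtFun (SymMatrix (Fin n))} {s : Set (SymMatrix (Fin n))} {C : ℝ}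
    (hpos : 0 < N) (hlt : N < n) (hη : 0 < η) (hf : ∀ X ∈ spectralBox (Fin n), f X ≤ C)
    (hscalar : ∀ a, ∃ c : ℝ, |c - N / n| ≤ ‖a‖ ∧
      (c • 1 ∈ spectralBox (Fin n) → c • 1 ∈ f.dom) ∧ c • 1 + a ∈ s) :
    ConsensusSlater f (l1On s η) (boxIndicator (Fin n)) := by
  have hn : (0 : ℝ) < n := by exact_mod_cast hpos.trans hlt
  have hNn : 0 < (N : ℝ) / n := by positivity
  have hNn' : (N : ℝ) / n < 1 := (div_lt_one hn).2 (by exact_mod_cast hlt)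
  set ρ := min ((N : ℝ) / n) (1 - N / n) / 2 with hρ
  have hρ_le : 2 * ρ ≤ N / n ∧ 2 * ρ ≤ 1 - N / n := by
    rw [hρ, mul_div_cancel₀ _ two_ne_zero]
    exact ⟨min_le_left _ _, min_le_right _ _⟩
  refine ⟨ρ, half_pos (lt_min hNn (sub_pos.2 hNn')),
    max (√n) (C + 1 / η * (n * (√n + ρ))), fun a b ha hb => ?_⟩
  obtain ⟨c, hc, hdom, hs⟩ := hscalar a
  obtain ⟨hc_ge, hc_le⟩ := abs_le.1 (hc.trans ha)
  have hadd_mem : ∀ b : SymMatrix (Fin n), ‖b‖ ≤ ρ → c • 1 + b ∈ spectralBox (Fin n) :=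
    fun b hb => smul_one_add_mem_spectralBox (by linarith) (by linarith)
  have hmem : c • 1 ∈ spectralBox (Fin n) := by
    simpa using hadd_mem 0 (norm_zero.trans_le ((norm_nonneg a).trans ha))
  have hnorm : ‖c • (1 : SymMatrix (Fin n))‖ ≤ √n := by
    simpa only [Fintype.card_fin] using norm_le_sqrt_card hmem
  refine ⟨c • 1, hdom hmem, hs, hadd_mem b hb, hnorm.trans (le_max_left _ _),
    le_max_of_le_right (add_le_add (hf _ hmem) ?_)⟩
  calc _ = 1 / η * entrywiseL1 ((c • 1 + a : SymMatrix (Fin n)) : Matrix (Fin n) (Fin n) ℝ) :=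
        add_zero _
    _ ≤ 1 / η * (n * ‖c • 1 + a‖) := by gcongr; exact entrywiseL1_le _
    _ ≤ _ := by gcongr; exact (norm_add_le _ _).trans (add_le_add hnorm ha)

end SymMatrix

end EntrywiseL1

section SymmStep

open SymMatrix

variable {n N : ℕ} {lam r : ℝ} {f g : ExtFun (SymMatrix (Fin n))} {t t' : State n}
  {s : ℕ → State n} {X : SymMatrix (Fin n)}

/-- One pass `t ↦ t'` of the alternating direction method for `f + g + boxIndicator`, in the
variables of the algorithms. -/
structure IsSymmStep (f g : ExtFun (SymMatrix (Fin n))) (lam r : ℝ) (t t' : State n) : Prop where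
  isSymm_P : t'.P.IsSymm
  isSymm_Q : t'.Q.IsSymm
  P_prox : IsProxAt f (lam + r)
    ((lam + r)⁻¹ • (lam • symPart (t.Q - t.B) + r • symPart (t.R - t.D))) (symPart t'.P)
  Q_prox : IsProxAt g lam (symPart (t'.P + t.B)) (symPart t'.Q)
  R_eq : t'.R = clipEig (t'.P + t.D)
  B_eq : t'.B = t.B + t'.P - t'.Q
  D_eq : t'.D = t.D + t'.P - t'.R

theorem clipEig_eq_coe_specMap {A : Matrix (Fin n) (Fin n) ℝ} (hA : A.IsSymm) :
    clipEig A = (specMap (fun x => min (max x 0) 1) (symPart A) : SymMatrix (Fin n)) := by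
  lift A to SymMatrix (Fin n) using hA
  rw [symPart_coe, coe_specMap, clipEig]

theorem IsSymmStep.isSymm (hstep : IsSymmStep f g lam r t t') (ht : t.IsSymm) : t'.IsSymm := by
  obtain ⟨-, -, hB, hD⟩ := ht
  have hR : t'.R.IsSymm := by
    rw [hstep.R_eq, clipEig_eq_coe_specMap (hstep.isSymm_P.add hD)]
    exact SymMatrix.isSymm _
  refine ⟨hstep.isSymm_Q, hR, ?_, ?_⟩
  · rw [hstep.B_eq]
    exact (hB.add hstep.isSymm_P).sub hstep.isSymm_Q
  · rw [hstep.D_eq]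
    exact (hD.add hstep.isSymm_P).sub hR

theorem isConsensusADMM_symPart (hr : 0 < r) (hs : ∀ k, (s k).IsSymm)
    (hstep : ∀ k, IsSymmStep f g lam r (s k) (s (k + 1))) :
    IsConsensusADMM f g (boxIndicator (Fin n)) lam r (fun k => symPart (s k).P)
      (fun k => symPart (s k).Q) (fun k => symPart (s k).R) (fun k => symPart (s k).B)
      (fun k => symPart (s k).D) where
  P_prox k := by simpa only [map_sub] using (hstep k).P_prox
  Q_prox k := by simpa only [map_add] using (hstep k).Q_prox
  R_prox k := by
    have hprox := isProxAt_boxIndicator hr.le (symPart ((s (k + 1)).P + (s k).D))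
    rwa [← symPart_coe (specMap _ _),
      ← clipEig_eq_coe_specMap ((hstep k).isSymm_P.add (hs k).2.2.2), ← (hstep k).R_eq,
      map_add] at hprox
  B_eq k := by rw [(hstep k).B_eq, map_sub, map_add]
  D_eq k := by rw [(hstep k).D_eq, map_sub, map_add]

theorem convergesTo_of_tendsto_symPart (hP : ∀ k, (s (k + 1)).P.IsSymm)
    (hQR : ∀ k, (s k).IsSymm) (hPX : Tendsto (fun k => symPart (s k).P) atTop (𝓝 X))
    (hQX : Tendsto (fun k => symPart (s k).Q) atTop (𝓝 X))
    (hRX : Tendsto (fun k => symPart (s k).R) atTop (𝓝 X)) : ConvergesTo s X := by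
  have hPX' := (continuous_toMatrix.tendsto X).comp ((tendsto_add_atTop_iff_nat 1).2 hPX)
  have hQX' := (continuous_toMatrix.tendsto X).comp hQX
  have hRX' := (continuous_toMatrix.tendsto X).comp hRX
  simp only [Function.comp_def, coe_symPart (hP _), coe_symPart (hQR _).1,
    coe_symPart (hQR _).2.1] at hPX' hQX' hRX'
  exact ((tendsto_add_atTop_iff_nat 1).1 hPX').prodMk_nhds (hQX'.prodMk_nhds hRX')

theorem IsBoxSplitting.exists_convergesTo {energy : Matrix (Fin n) (Fin n) ℝ → ℝ}
    (hsplit : IsBoxSplitting N f g lam r) (hlam : 0 < lam) (hr : 0 < r) (hN : N ≤ n)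
    (hs₀ : (s 0).IsSymm) (hstep : ∀ k, (s k).IsSymm → IsSymmStep f g lam r (s k) (s (k + 1)))
    (henergy : ∀ X : SymMatrix (Fin n), energy X = f X + g X) :
    ∃ p, (p ∈ feasible n N ∧ IsMinOn energy (feasible n N) p) ∧ ConvergesTo s p := by
  have hs : ∀ k, (s k).IsSymm := fun k => by
    induction k with
    | zero => exact hs₀
    | succ k ih => exact (hstep k ih).isSymm ih
  obtain ⟨p, hp, hmin, hP, hQ, hR⟩ := hsplit.exists_tendsto
    (isConsensusADMM_symPart hr hs fun k => hstep k (hs k)) hlam hr hN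
  refine ⟨p, ⟨coe_mem_feasible_iff.2 hp, fun X hX => ?_⟩,
    convergesTo_of_tendsto_symPart (fun k => (hstep k (hs k)).isSymm_P) hs hP hQ hR⟩
  lift X to SymMatrix (Fin n) using hX.1
  simpa only [Set.mem_ofPred_eq, henergy] using hmin (coe_mem_feasible_iff.1 hX)

end SymmStep

section ZeroTemperature

open SymMatrix

variable {n N : ℕ} {η lam r : ℝ}

theorem isBoxSplitting_zeroTemp (hN : N ≤ n) (hη : 0 < η) (hlam : 0 < lam) (hr : 0 < r)
    (H : SymMatrix (Fin n)) :
    IsBoxSplitting N (linearOnSlice N H) (l1On Set.univ η) lam r where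
  prox :=
    { left := fun w => ⟨_, isProxAt_linearOnSlice hN (add_pos hlam hr).ne' H w⟩
      middle := exists_isProxAt_l1On_univ hη hlam
      right := fun w => ⟨_, isProxAt_boxIndicator hr.le w⟩ }
  inter_dom := by
    simp only [linearOnSlice, l1On, Set.univ_inter, Set.inter_comm]
  dom_subset := Or.inl subset_rfl
  slater hpos hlt := consensusSlater_l1On (C := ‖H‖ * √(Fintype.card (Fin n))) hpos hlt hη
    (fun X hX => (real_inner_le_norm H X).trans
      (mul_le_mul_of_nonneg_left (norm_le_sqrt_card hX) (norm_nonneg H)))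
    fun a => ⟨N / n, by simp, fun _ => (smul_one_mem_spectralBox_inter_traceSlice hN).2, trivial⟩

theorem zeroTempP_coe (H Q R B D : SymMatrix (Fin n)) (P : Matrix (Fin n) (Fin n) ℝ) :
    zeroTempP (H : Matrix (Fin n) (Fin n) ℝ) N lam r ⟨P, Q, R, B, D⟩
      = (traceProj N ((lam + r)⁻¹ • (lam • (Q - B) + r • (R - D)) - (lam + r)⁻¹ • H) :
        SymMatrix (Fin n)) := by
  simp only [zeroTempP, traceProj, map_sub, map_add, map_smul, coe_one, smul_add, smul_smul,
    div_eq_inv_mul, mul_one]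

theorem isSymmStep_zeroTempStep {H : Matrix (Fin n) (Fin n) ℝ} {t : State n} (hN : N ≤ n)
    (hH : H.IsSymm) (hη : 0 < η) (hlam : 0 < lam) (hr : 0 < r) (ht : t.IsSymm) :
    IsSymmStep (linearOnSlice N (symPart H)) (l1On Set.univ η) lam r t
      (zeroTempStep H N η lam r t) := by
  obtain ⟨P, Q, R, B, D⟩ := t
  obtain ⟨hQ, hR, hB, hD⟩ := ht
  lift H to SymMatrix (Fin n) using hH
  lift Q to SymMatrix (Fin n) using hQ
  lift R to SymMatrix (Fin n) using hR
  lift B to SymMatrix (Fin n) using hB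
  lift D to SymMatrix (Fin n) using hD
  have hP := zeroTempP_coe (N := N) (lam := lam) (r := r) H Q R B D P
  have hshrink_symm : ((zeroTempP H N lam r ⟨P, Q, R, B, D⟩ + B).map
      fun x => shrink x (1 / (lam * η))).IsSymm := by
    rw [hP, ← map_add]
    exact (isSymm _).map _
  exact
    { isSymm_P := by rw [zeroTempStep, hP]; exact isSymm _
      isSymm_Q := hshrink_symm
      P_prox := by
        simp only [zeroTempStep, hP, map_sub, symPart_coe]
        exact isProxAt_linearOnSlice hN (add_pos hlam hr).ne' H _
      Q_prox := by
        refine isProxAt_l1On_univ hη hlam fun i j => ?_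
        rw [zeroTempStep, coe_symPart hshrink_symm, map_apply, hP, ← map_add, symPart_coe]
      R_eq := rfl
      B_eq := rfl
      D_eq := rfl }

theorem exists_zeroTemp_convergesTo {H : Matrix (Fin n) (Fin n) ℝ} {s₀ : State n} (hN : N ≤ n)
    (hH : H.IsSymm) (hη : 0 < η) (hlam : 0 < lam) (hr : 0 < r) (hs₀ : s₀.IsSymm) :
    ∃ P, IsZeroTempMinimizer H N η P ∧
      ConvergesTo (fun k => (zeroTempStep H N η lam r)^[k] s₀) P := by
  refine (isBoxSplitting_zeroTemp hN hη hlam hr (symPart H)).exists_convergesTo hlam hr hN hs₀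
    (fun k hk => ?_) fun X => ?_
  · rw [Function.iterate_succ_apply']
    exact isSymmStep_zeroTempStep hN hH hη hlam hr hk
  · simp only [energyZeroTemp, linearOnSlice, l1On, inner_eq_trace, coe_symPart hH]

end ZeroTemperature

section Entropy

theorem fermi_eq_sigmoid (β x : ℝ) : 1 / (1 + Real.exp (β * x)) = Real.sigmoid (-(β * x)) := by
  rw [Real.sigmoid_def, neg_neg, one_div]

theorem abs_sigmoid_sub_le (x y : ℝ) : |Real.sigmoid x - Real.sigmoid y| ≤ 1 / 4 * |x - y| := by
  refine convex_univ.norm_image_sub_le_of_norm_deriv_le (fun _ _ => differentiableAt_sigmoid)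
    (fun z _ => ?_) (Set.mem_univ y) (Set.mem_univ x)
  rw [Real.deriv_sigmoid, Real.norm_eq_abs, abs_of_nonneg
    (mul_nonneg (Real.sigmoid_nonneg z) (sub_nonneg.2 (Real.sigmoid_le_one z)))]
  linarith [sq_nonneg (Real.sigmoid z - 1 / 2)]

theorem abs_fermi_sub_le {β : ℝ} (hβ : 0 ≤ β) (x y : ℝ) :
    |1 / (1 + Real.exp (β * x)) - 1 / (1 + Real.exp (β * y))| ≤ β / 4 * |x - y| := by
  rw [fermi_eq_sigmoid, fermi_eq_sigmoid]
  refine (abs_sigmoid_sub_le _ _).trans_eq ?_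
  rw [neg_sub_neg, ← mul_sub, abs_mul, abs_of_nonneg hβ, abs_sub_comm]
  ring

theorem antitone_fermi {β : ℝ} (hβ : 0 ≤ β) : Antitone fun x => 1 / (1 + Real.exp (β * x)) := by
  intro x y hxy
  simp only
  gcongr

theorem fermi_mem_Icc (β x : ℝ) : 1 / (1 + Real.exp (β * x)) ∈ Set.Icc 0 1 := by
  rw [fermi_eq_sigmoid]
  exact ⟨Real.sigmoid_nonneg _, Real.sigmoid_le_one _⟩

theorem entropy_nonpos {x : ℝ} (hx : x ∈ Set.Icc 0 1) : entropy x ≤ 0 :=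
  add_nonpos (mul_nonpos_of_nonneg_of_nonpos hx.1 (Real.log_nonpos hx.1 hx.2))
    (mul_nonpos_of_nonneg_of_nonpos (sub_nonneg.2 hx.2)
      (Real.log_nonpos (sub_nonneg.2 hx.2) (sub_le_self 1 hx.1)))

theorem mul_log_add_sub_le {x p : ℝ} (hx : 0 ≤ x) (hp : 0 < p) :
    x * Real.log p + (x - p) ≤ x * Real.log x := by
  rcases hx.eq_or_lt with rfl | hx
  · simpa using hp.le
  have hlog := Real.log_le_sub_one_of_pos (div_pos hp hx)
  rw [Real.log_div hp.ne' hx.ne', le_sub_iff_add_le, le_div_iff₀ hx] at hlog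
  linarith

/-- The derivative of the entropy at the occupation number `1 / (1 + exp t)` is `-t`. -/
theorem entropy_fermi_sub_le {x : ℝ} (hx : x ∈ Set.Icc 0 1) (t : ℝ) :
    entropy (1 / (1 + Real.exp t)) + -t * (x - 1 / (1 + Real.exp t)) ≤ entropy x := by
  have hexp := Real.exp_pos t
  set p : ℝ := 1 / (1 + Real.exp t) with hp
  have hp_pos : 0 < p := by positivity
  have hone_sub : 1 - p = Real.exp t * p := by
    rw [hp]
    field_simp
    ring
  have hlog : Real.log (1 - p) = t + Real.log p := by
    rw [hone_sub, Real.log_mul hexp.ne' hp_pos.ne', Real.log_exp]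
  have hone_sub_pos : 0 < 1 - p := hone_sub ▸ mul_pos hexp hp_pos
  have hx_log := mul_log_add_sub_le hx.1 hp_pos
  have hone_sub_log := mul_log_add_sub_le (sub_nonneg.2 hx.2) hone_sub_pos
  rw [hlog] at hone_sub_log
  rw [entropy, entropy, hlog]
  linarith

end Entropy

section FreeEnergy

namespace SymMatrix

variable {ι : Type*} [Fintype ι] [DecidableEq ι] {β μ : ℝ} {H w p : SymMatrix ι}

/-- The smooth part `tr (H X) + β⁻¹ tr (X ln X + (1 - X) ln (1 - X))` of the finite temperature
energy, on the spectral box. -/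
noncomputable def freeEnergy (β : ℝ) (H : SymMatrix ι) : ExtFun (SymMatrix ι) where
  dom := spectralBox ι
  toFun X := ⟪H, X⟫ + 1 / β * (specMap entropy X : Matrix ι ι ℝ).trace

/-- The map iterated by the inner loop; its fixed points are the proximal points of
`freeEnergy β H` at `w`. -/
noncomputable def fermiStep (β μ : ℝ) (H w Z : SymMatrix ι) : SymMatrix ι :=
  specMap (fun x => 1 / (1 + Real.exp (β * x))) (H + μ • (Z - w))

theorem freeEnergy_le {X : SymMatrix ι} (hβ : 0 ≤ β) (hX : X ∈ spectralBox ι) :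
    freeEnergy β H X ≤ ‖H‖ * √(Fintype.card ι) := by
  have hentropy : (specMap entropy X : Matrix ι ι ℝ).trace ≤ 0 := by
    rw [trace_specMap]
    exact Finset.sum_nonpos fun i _ => entropy_nonpos (eigenvalue_mem_Icc hX i)
  refine (add_le_of_nonpos_right (mul_nonpos_of_nonneg_of_nonpos (by positivity) hentropy)).trans
    ((real_inner_le_norm H X).trans ?_)
  gcongr
  exact norm_le_sqrt_card hX

theorem isProxAt_freeEnergy (hβ : 0 < β) (hp : fermiStep β μ H w p = p) :
    IsProxAt (freeEnergy β H) μ w p := by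
  refine ⟨hp ▸ specMap_mem_spectralBox (fermi_mem_Icc β) _, fun X hX => ?_⟩
  have htrace := trace_specMap_comp_le (ψ := entropy) (g := fun x => -β * x)
    (eigenvalue_mem_Icc hX) (fun a x hx => neg_mul β a ▸ entropy_fermi_sub_le hx (β * a))
    (H + μ • (p - w))
  rw [← fermiStep, hp, specMap_const_mul, specMap_id, real_inner_smul_left, inner_add_left,
    real_inner_smul_left, ← neg_sub w p, inner_neg_left, inner_sub_right] at htrace
  have hscaled := mul_le_mul_of_nonneg_left htrace (one_div_pos.2 hβ).le
  rw [mul_add, ← mul_assoc, mul_neg, one_div_mul_cancel hβ.ne'] at hscaled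
  simp only [freeEnergy]
  linarith

theorem norm_fermiStep_sub_le (hβ : 0 ≤ β) (hμ : 0 ≤ μ) (H w Z Z' : SymMatrix ι) :
    ‖fermiStep β μ H w Z - fermiStep β μ H w Z'‖ ≤ β * μ / 4 * ‖Z - Z'‖ := by
  refine (norm_specMap_sub_le (by positivity) (abs_fermi_sub_le hβ) _ _).trans_eq ?_
  rw [add_sub_add_left_eq_sub, ← smul_sub, sub_sub_sub_cancel_right, norm_smul, Real.norm_eq_abs,
    abs_of_nonneg hμ]
  ring

theorem lipschitzWith_fermiStep (hβ : 0 ≤ β) (hμ : 0 ≤ μ) (H w : SymMatrix ι) :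
    LipschitzWith (Real.toNNReal (β * μ / 4)) (fermiStep β μ H w) :=
  LipschitzWith.of_dist_le_mul fun Z Z' => by
    rw [dist_eq_norm, dist_eq_norm, Real.coe_toNNReal _ (by positivity)]
    exact norm_fermiStep_sub_le hβ hμ H w Z Z'

theorem inner_fermiStep_sub_nonpos (hβ : 0 ≤ β) (hμ : 0 < μ) (H w Z Z' : SymMatrix ι) :
    ⟪fermiStep β μ H w Z - fermiStep β μ H w Z', Z - Z'⟫ ≤ 0 := by
  have hanti := inner_specMap_sub_nonpos (antitone_fermi hβ) (H + μ • (Z - w)) (H + μ • (Z' - w))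
  rw [add_sub_add_left_eq_sub, ← smul_sub, sub_sub_sub_cancel_right, real_inner_smul_right]
    at hanti
  exact nonpos_of_mul_nonpos_right hanti hμ

theorem exists_isProxAt_freeEnergy (hβ : 0 < β) (hμ : 0 < μ) (H w : SymMatrix ι) :
    ∃ p, IsProxAt (freeEnergy β H) μ w p :=
  (exists_fixedPoint_of_antitone (inner_fermiStep_sub_nonpos hβ.le hμ H w)
    (norm_fermiStep_sub_le hβ.le hμ.le H w)).imp fun _ => isProxAt_freeEnergy hβ

theorem contractingWith_fermiStep (hβ : 0 ≤ β) (hμ : 0 ≤ μ) (hlt : β * μ < 4)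
    (H w : SymMatrix ι) :
    ContractingWith (Real.toNNReal (β * μ / 4)) (fermiStep β μ H w) :=
  ⟨Real.toNNReal_lt_one.2 ((div_lt_one four_pos).2 hlt), lipschitzWith_fermiStep hβ hμ H w⟩

end SymMatrix

end FreeEnergy

section FiniteTemperature

open SymMatrix

variable {n N : ℕ} {β η lam r : ℝ}

theorem isBoxSplitting_finiteTemp (hN : N ≤ n) (hβ : 0 < β) (hη : 0 < η) (hlam : 0 < lam)
    (hr : 0 < r) (H : SymMatrix (Fin n)) :
    IsBoxSplitting N (freeEnergy β H) (l1On (traceSlice n N) η) lam r where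
  prox :=
    { left := exists_isProxAt_freeEnergy hβ (add_pos hlam hr) H
      middle := exists_isProxAt_l1On_traceSlice hN hη hlam
      right := fun w => ⟨_, isProxAt_boxIndicator hr.le w⟩ }
  inter_dom := by
    simp only [freeEnergy, l1On]
    rw [Set.inter_left_comm, Set.inter_self, Set.inter_comm]
  dom_subset := Or.inr subset_rfl
  slater hpos hlt := by
    refine consensusSlater_l1On hpos hlt hη (fun X => freeEnergy_le hβ.le) fun a =>
      ⟨(N - (a : Matrix (Fin n) (Fin n) ℝ).trace) / n, ?_, id, ?_⟩
    · rw [← sub_div, sub_sub_cancel_left, abs_div, abs_neg, Nat.abs_cast]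
      refine div_le_of_le_mul₀ n.cast_nonneg (norm_nonneg a) ?_
      simpa [mul_comm] using abs_trace_le a
    · rw [← traceProj_sub_self, sub_add_cancel]
      exact traceProj_mem_traceSlice hN a

theorem innerIter_coe (hne : lam + r ≠ 0) (H Q R B D Z : SymMatrix (Fin n))
    (P : Matrix (Fin n) (Fin n) ℝ) (l : ℕ) :
    innerIter (H : Matrix (Fin n) (Fin n) ℝ) β lam r ⟨P, Q, R, B, D⟩ Z l
      = ((fermiStep β (lam + r) H ((lam + r)⁻¹ • (lam • (Q - B) + r • (R - D))))^[l] Z :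
        SymMatrix (Fin n)) := by
  have harg (W : SymMatrix (Fin n)) :
      H + (lam + r) • (W - (lam + r)⁻¹ • (lam • (Q - B) + r • (R - D)))
        = H + lam • (W - Q + B) + r • (W - R + D) := by
    rw [smul_sub (lam + r), smul_inv_smul₀ hne]
    module
  induction l with
  | zero => rfl
  | succ l ih =>
    rw [innerIter, ih, Function.iterate_succ_apply', fermiStep, harg, coe_specMap, fermiDirac]
    simp only [map_add, map_sub, map_smul]

variable {H Z₀ : Matrix (Fin n) (Fin n) ℝ} {t t' : State n}

theorem isSymmStep_of_isFiniteTempStep (hβ : 0 < β) (hη : 0 < η) (hlam : 0 < lam) (hr : 0 < r)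
    (hH : H.IsSymm) (hZ₀ : Z₀.IsSymm) (ht : t.IsSymm)
    (hstep : IsFiniteTempStep H N β η lam r Z₀ t t') :
    IsSymmStep (freeEnergy β (symPart H)) (l1On (traceSlice n N) η) lam r t t' := by
  obtain ⟨P, Q, R, B, D⟩ := t
  obtain ⟨P', Q', R', B', D'⟩ := t'
  obtain ⟨hQ, hR, hB, hD⟩ := ht
  obtain ⟨hlim, hoff, hdiag, hR', hB', hD'⟩ := hstep
  simp only at hQ hR hB hD hlim hoff hdiag hR' hB' hD'
  lift H to SymMatrix (Fin n) using hH
  lift Z₀ to SymMatrix (Fin n) using hZ₀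
  lift Q to SymMatrix (Fin n) using hQ
  lift R to SymMatrix (Fin n) using hR
  lift B to SymMatrix (Fin n) using hB
  lift D to SymMatrix (Fin n) using hD
  have hcoe := funext (innerIter_coe (β := β) (add_pos hlam hr).ne' H Q R B D Z₀ P)
  rw [hcoe] at hlim
  obtain ⟨p, rfl, hp⟩ := exists_tendsto_of_tendsto_coe hlim
  have hfix := isFixedPt_of_tendsto_iterate hp (lipschitzWith_fermiStep hβ.le
    (add_pos hlam hr).le H _).continuous.continuousAt
  have hQ'_symm : Q'.IsSymm :=
    isSymm_of_offDiag_eq (φ := fun x => shrink x (lam * η)⁻¹) (p.isSymm.add B.isSymm) hoff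
  lift Q' to SymMatrix (Fin n) using hQ'_symm
  rw [← map_add] at hoff hdiag
  exact
    { isSymm_P := p.isSymm
      isSymm_Q := Q'.isSymm
      P_prox := by simpa only [map_sub, symPart_coe] using isProxAt_freeEnergy hβ hfix
      Q_prox := by
        simpa only [map_add, symPart_coe] using isProxAt_l1On_traceSlice hη hlam hoff hdiag
      R_eq := hR'
      B_eq := hB'
      D_eq := hD' }

theorem exists_isFiniteTempStep (hN : N ≤ n) (hβ : 0 < β) (hη : 0 < η) (hlam : 0 < lam)
    (hr : 0 < r) (hlt : β * (lam + r) < 4) (hH : H.IsSymm) (hZ₀ : Z₀.IsSymm) (ht : t.IsSymm) :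
    ∃ t', IsFiniteTempStep H N β η lam r Z₀ t t' := by
  obtain ⟨p, hp⟩ : ∃ p, Tendsto (innerIter H β lam r t Z₀) atTop (𝓝 p) := by
    obtain ⟨P, Q, R, B, D⟩ := t
    obtain ⟨hQ, hR, hB, hD⟩ := ht
    lift H to SymMatrix (Fin n) using hH
    lift Z₀ to SymMatrix (Fin n) using hZ₀
    lift Q to SymMatrix (Fin n) using hQ
    lift R to SymMatrix (Fin n) using hR
    lift B to SymMatrix (Fin n) using hB
    lift D to SymMatrix (Fin n) using hD
    rw [funext (innerIter_coe (add_pos hlam hr).ne' H Q R B D Z₀ P)]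
    exact ⟨_, (continuous_toMatrix.tendsto _).comp
      ((contractingWith_fermiStep hβ.le (add_pos hlam hr).le hlt H _).tendsto_iterate_fixedPoint
        Z₀)⟩
  obtain ⟨Q, hoff, hdiag⟩ := exists_shrink_offDiag_isDiagUpdate hN hη hlam (p + t.B)
  exact ⟨⟨p, Q, clipEig (p + t.D), t.B + p - Q, t.D + p - clipEig (p + t.D)⟩,
    hp, hoff, hdiag, rfl, rfl, rfl⟩

variable {Z : ℕ → Matrix (Fin n) (Fin n) ℝ} {s₀ : State n} {s : ℕ → State n}

theorem exists_isFiniteTempRun (hN : N ≤ n) (hβ : 0 < β) (hη : 0 < η) (hlam : 0 < lam)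
    (hr : 0 < r) (hlt : β * (lam + r) < 4) (hH : H.IsSymm) (hZ : ∀ k, (Z k).IsSymm)
    (hs₀ : s₀.IsSymm) : ∃ s, s 0 = s₀ ∧ IsFiniteTempRun H N β η lam r Z s := by
  have : Nonempty (State n) := ⟨s₀⟩
  choose! next hnext using fun k t (ht : State.IsSymm t) =>
    exists_isFiniteTempStep hN hβ hη hlam hr hlt hH (hZ k) ht
  let s : ℕ → State n := Nat.rec s₀ next
  have hs : ∀ k, (s k).IsSymm := fun k => by
    induction k with
    | zero => exact hs₀
    | succ k ih =>
      exact (isSymmStep_of_isFiniteTempStep hβ hη hlam hr hH (hZ k) ih (hnext k _ ih)).isSymm ih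
  exact ⟨s, rfl, fun k => hnext k _ (hs k)⟩

theorem exists_finiteTemp_convergesTo (hN : N ≤ n) (hβ : 0 < β) (hη : 0 < η) (hlam : 0 < lam)
    (hr : 0 < r) (hH : H.IsSymm) (hZ : ∀ k, (Z k).IsSymm) (hs₀ : (s 0).IsSymm)
    (hrun : IsFiniteTempRun H N β η lam r Z s) :
    ∃ P, IsFiniteTempMinimizer H N β η P ∧ ConvergesTo s P :=
  (isBoxSplitting_finiteTemp hN hβ hη hlam hr (symPart H)).exists_convergesTo hlam hr hN hs₀
    (fun k hk => isSymmStep_of_isFiniteTempStep hβ hη hlam hr hH (hZ k) hk (hrun k)) fun X => by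
      simp only [energyFiniteTemp, freeEnergy, l1On, inner_eq_trace, coe_symPart hH, coe_specMap]

end FiniteTemperature

end LDM

theorem theorem3 {n : ℕ} (N : ℕ) (hN : N ≤ n) (H : Matrix (Fin n) (Fin n) ℝ) (hH : H.IsSymm)
    (η lam r : ℝ) (hη : 0 < η) (hlam : 0 < lam) (hr : 0 < r)
    (s₀ : LDM.State n) (hs₀ : s₀.IsSymm) :
    (∃ Pstar, LDM.IsZeroTempMinimizer H N η Pstar ∧
      LDM.ConvergesTo (fun k => (LDM.zeroTempStep H N η lam r)^[k] s₀) Pstar) ∧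
    (∀ β : ℝ, 0 < β →
      ∀ Z₀ : ℕ → Matrix (Fin n) (Fin n) ℝ, (∀ k, (Z₀ k).IsSymm) →
        (β * (lam + r) < 4 → ∃ s, s 0 = s₀ ∧ LDM.IsFiniteTempRun H N β η lam r Z₀ s) ∧
        (∀ s, s 0 = s₀ → LDM.IsFiniteTempRun H N β η lam r Z₀ s →
          ∃ Pstar, LDM.IsFiniteTempMinimizer H N β η Pstar ∧ LDM.ConvergesTo s Pstar)) := by
  refine ⟨LDM.exists_zeroTemp_convergesTo hN hH hη hlam hr hs₀, fun β hβ Z₀ hZ₀ => ⟨fun hlt => ?_,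
    fun s hs hrun => ?_⟩⟩
  · exact LDM.exists_isFiniteTempRun hN hβ hη hlam hr hlt hH hZ₀ hs₀
  · exact LDM.exists_finiteTemp_convergesTo hN hβ hη hlam hr hH hZ₀ (hs ▸ hs₀) hrun
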